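/- Let $m\ge 1$ be odd, $0\le r\le (m-1)/2$, $N=2^m$ and $\mathcal C=2^{(r+2)m}$. Let $DG(m,r)$ be a Delsarte–Goethals set, i.e. an $\mathbb F_2$-vector space consisting of $2^{(r+1)m}$ binary symmetric $m\times m$ matrices such that the difference of any two distinct members has rank at least $m-2r$ over $\mathbb F_2$. For $P\in DG(m,r)$ and $b,x\in\mathbb F_2^m$ put $$\varphi_{P,b}(x)=i^{\,\mathrm{wt}(d_P)+2\,\mathrm{wt}(b)}\; i^{\,xPx^\top+2bx^\top},$$ where $d_P$ is the diagonal of $P$, $\mathrm{wt}$ is the Hamming weight, and the second exponent is computed in the integers from the lifts of the entries to $\{0,1\}$. Number the $\mathcal C$ pairs $(P,b)$, in any order, as $(P_1,b_1),\dots,(P_{\mathcal C},b_{\mathcal C})$; the functions $\varphi_{P_c,b_c}$ are the columns of the Delsarte–Goethals sensing matrix. Fix an offset $a\in\mathbb F_2^m$ with $a\ne 0$, an integer $0\le k\le\mathcal C$ and $\alpha=(\alpha_1,\dots,\alpha_k)\in\mathbb C^k$ with Euclidean norm $\|\alpha\|$. For $\ell\in\mathbb F_2^m$ and distinct $t_1,\dots,t_k\in\{1,\dots,\mathcal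 C\}$ let $$\Gamma_a^{\ell}(t_1,\dots,t_k)=\frac1{N^{3/2}}\sum_{i\ne j}\alpha_i\overline{\alpha_j}\sum_{x\in\mathbb F_2^m}(-1)^{\ell x^\top}\varphi_{P_{t_i},b_{t_i}}(x+a)\,\overline{\varphi_{P_{t_j},b_{t_j}}(x)} .$$ Theorem. Let $\pi$ be a uniformly random permutation of $\{1,\dots,\mathcal C\}$ and let $\delta>0$. Then with probability at least $1-\delta$, simultaneously for all $\ell\in\mathbb F_2^m$, $$\bigl|\Gamma_a^{\ell}(\pi_1,\dots,\pi_k)\bigr|\;\le\;\sqrt{\frac{8k\log(N/\delta)}{N^{1-r/m}}}\;\|\alpha\|^2$$ (for $\delta\ge 1$ the probability statement is empty; $\log$ is the natural logarithm). -/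

import Mathlib

/-- Binary `m`-tuples. -/
abbrev BinVec (m : ℕ) : Type := Fin m → ZMod 2

/-- Binary `m × m` matrices. -/
abbrev BinMat (m : ℕ) : Type := Matrix (Fin m) (Fin m) (ZMod 2)

/-- `D` is a Delsarte–Goethals set `DG(m,r)`: a binary vector space consisting of `2^((r+1)m)`
binary symmetric `m × m` matrices such that the difference of any two distinct members has rank
at least `m - 2r` over the field with two elements. -/
structure IsDelsarteGoethals (m r : ℕ) (D : Submodule (ZMod 2) (BinMat m)) : Prop where
  symm : ∀ P ∈ D, P.IsSymm
  card : Nat.card D = 2 ^ ((r + 1) * m)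
  rank : ∀ P ∈ D, ∀ Q ∈ D, P ≠ Q → m ≤ (P - Q).rank + 2 * r

section Existence

/-- The classical Delsarte–Goethals form over an extension `K` of the field with two elements:
`(y, x) ↦ z₀ y x + ∑_{t=1}^r z_t (y^(2^t) x + y x^(2^t))`. -/
def dgForm {K : Type*} [Field K] {r : ℕ} (z : Fin (r + 1) → K) (y x : K) : K :=
  z 0 * (y * x) + ∑ t : Fin r, z t.succ * (y ^ 2 ^ (t.val + 1) * x + y * x ^ 2 ^ (t.val + 1))

/-- The linear map sending `z = (z₀, …, z_r)` to the matrix of the symmetric bilinear form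
`Tr (dgForm z y x)` in the basis `e`. -/
noncomputable def dgMatrix {K : Type*} [Field K] [Algebra (ZMod 2) K] {m : ℕ}
    (e : Module.Basis (Fin m) (ZMod 2) K) (r : ℕ) : (Fin (r + 1) → K) →ₗ[ZMod 2] BinMat m where
  toFun z := Matrix.of fun i j => Algebra.trace (ZMod 2) K (dgForm z (e i) (e j))
  map_add' z w := by
    ext i j
    simp only [dgForm, Matrix.of_apply, Matrix.add_apply, ← map_add, Pi.add_apply, add_mul,
      Finset.sum_add_distrib]
    congr 1
    ring
  map_smul' c z := by
    ext i j
    simp only [dgForm, Matrix.of_apply, Matrix.smul_apply, ← map_smul, Pi.smul_apply, smul_add,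
      Finset.smul_sum, smul_mul_assoc, RingHom.id_apply]

/-- The classical trace construction of the Delsarte–Goethals set. -/
noncomputable def dgTraceSpace {K : Type*} [Field K] [Algebra (ZMod 2) K] {m : ℕ}
    (e : Module.Basis (Fin m) (ZMod 2) K) (r : ℕ) : Submodule (ZMod 2) (BinMat m) :=
  LinearMap.range (dgMatrix e r)

theorem trace_pow_two_pow {K : Type*} [Field K] [Finite K] [Algebra (ZMod 2) K] (w : K) (n : ℕ) :
    Algebra.trace (ZMod 2) K (w ^ 2 ^ n) = Algebra.trace (ZMod 2) K w := by
  induction n with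
  | zero => simp
  | succ n ih =>
    rw [← ih, pow_succ, pow_mul]
    have := Algebra.trace_eq_of_algEquiv (FiniteField.frobeniusAlgEquivOfAlgebraic (ZMod 2) K)
      (w ^ 2 ^ n)
    rwa [FiniteField.coe_frobeniusAlgEquivOfAlgebraic, ZMod.card] at this

theorem trace_dgForm {K : Type*} [Field K] [Finite K] [Algebra (ZMod 2) K] {r : ℕ}
    (z : Fin (r + 1) → K) (y x : K) :
    Algebra.trace (ZMod 2) K (dgForm z y x) = Algebra.trace (ZMod 2) K
      ((z 0 ^ 2 ^ r * x ^ 2 ^ r + ∑ t : Fin r, (z t.succ ^ 2 ^ r * x ^ 2 ^ (r + (t.val + 1)) +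
        z t.succ ^ 2 ^ (r - (t.val + 1)) * x ^ 2 ^ (r - (t.val + 1)))) * y ^ 2 ^ r) := by
  simp only [dgForm, add_mul, Finset.sum_mul, map_add, map_sum, mul_add]
  congr 1
  · rw [← trace_pow_two_pow _ r]
    congr 1
    ring
  · refine Finset.sum_congr rfl fun t _ => ?_
    rw [add_comm]
    congr 1
    · rw [← trace_pow_two_pow _ r]
      congr 1
      rw [mul_pow, mul_pow, ← pow_mul x, ← pow_add, add_comm r]
      ring
    · rw [← trace_pow_two_pow _ (r - (t.val + 1))]
      congr 1
      rw [mul_pow, mul_pow, ← pow_mul y, ← pow_add, Nat.add_sub_cancel' t.isLt]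
      ring

theorem dgForm_sum_right {K : Type*} [Field K] [Algebra (ZMod 2) K] {r m : ℕ}
    (z : Fin (r + 1) → K) (y : K) (c : Fin m → ZMod 2) (e : Fin m → K) :
    dgForm z y (∑ j, c j • e j) = ∑ j, c j • dgForm z y (e j) := by
  have : CharP K 2 := charP_of_injective_algebraMap (algebraMap (ZMod 2) K).injective 2
  have : ExpChar K 2 := ExpChar.prime Nat.prime_two
  have hp : ∀ n : ℕ, (∑ j, c j • e j) ^ 2 ^ n = ∑ j, c j • e j ^ 2 ^ n := by
    intro n
    rw [sum_pow_char_pow]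
    refine Finset.sum_congr rfl fun j _ => ?_
    rw [smul_pow, ZMod.pow_card_pow]
  simp only [dgForm, hp, Finset.mul_sum, mul_add, smul_add, Finset.sum_add_distrib,
    Finset.smul_sum, mul_smul_comm]
  congr 1
  congr 1 <;> exact Finset.sum_comm

theorem dgForm_comm {K : Type*} [Field K] {r : ℕ} (z : Fin (r + 1) → K) (y x : K) :
    dgForm z y x = dgForm z x y := by
  simp only [dgForm]
  congr 1
  · ring
  · exact Finset.sum_congr rfl fun t _ => by ring

theorem dgMatrix_ker_card {K : Type*} [Field K] [Finite K] [Algebra (ZMod 2) K] {m : ℕ}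
    (e : Module.Basis (Fin m) (ZMod 2) K) (r : ℕ) (z : Fin (r + 1) → K) (hz : z ≠ 0) :
    Nat.card (LinearMap.ker (dgMatrix e r z).mulVecLin) ≤ 2 ^ (2 * r) := by
  classical
  let q : Polynomial K := Polynomial.monomial (2 ^ r) (z 0 ^ 2 ^ r) +
    ∑ t : Fin r, (Polynomial.monomial (2 ^ (r + (t.val + 1))) (z t.succ ^ 2 ^ r) +
      Polynomial.monomial (2 ^ (r - (t.val + 1))) (z t.succ ^ 2 ^ (r - (t.val + 1))))
  have hinj : ∀ a b : ℕ, (2 ^ a = 2 ^ b) ↔ a = b := fun a b => Nat.pow_right_inj one_lt_two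
  have hq0 : q ≠ 0 := by
    intro h
    apply hz
    funext s
    refine Fin.cases ?_ (fun t => ?_) s
    · have := congrArg (fun p => Polynomial.coeff p (2 ^ r)) h
      simp only [q, Polynomial.coeff_add, Polynomial.finsetSum_coeff, Polynomial.coeff_monomial,
        hinj, Polynomial.coeff_zero] at this
      rw [Finset.sum_eq_zero] at this
      · simpa using this
      · intro t _
        rw [if_neg (by omega), if_neg (by omega), add_zero]
    · have := congrArg (fun p => Polynomial.coeff p (2 ^ (r + (t.val + 1)))) h
      simp only [q, Polynomial.coeff_add, Polynomial.finsetSum_coeff, Polynomial.coeff_monomial,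
        hinj, Polynomial.coeff_zero] at this
      rw [Finset.sum_eq_single t] at this
      · rw [if_neg (by omega), if_pos rfl, if_neg (by omega)] at this
        simpa using this
      · intro s _ hs
        have : s.val ≠ t.val := fun h => hs (Fin.ext h)
        rw [if_neg (by omega), if_neg (by omega), add_zero]
      · simp
  have hdeg : q.natDegree ≤ 2 ^ (2 * r) := by
    refine Polynomial.natDegree_add_le_of_degree_le ?_ ?_
    · exact (Polynomial.natDegree_monomial_le _).trans (Nat.pow_le_pow_right two_pos (by omega))
    · refine Polynomial.natDegree_sum_le_of_forall_le _ _ fun t _ => ?_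
      refine Polynomial.natDegree_add_le_of_degree_le ?_ ?_ <;>
      exact (Polynomial.natDegree_monomial_le _).trans (Nat.pow_le_pow_right two_pos (by omega))
  have : CharP K 2 := charP_of_injective_algebraMap (algebraMap (ZMod 2) K).injective 2
  have : ExpChar K 2 := ExpChar.prime Nat.prime_two
  have hroot : ∀ v : LinearMap.ker (dgMatrix e r z).mulVecLin,
      (∑ j, v.1 j • e j) ∈ (q.roots.toFinset : Finset K) := by
    rintro ⟨v, hv⟩
    set x : K := ∑ j, v j • e j with hx
    have h1 : ∀ i, Algebra.trace (ZMod 2) K (dgForm z (e i) x) = 0 := by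
      intro i
      have := congrFun (LinearMap.mem_ker.1 hv) i
      simp only [Matrix.mulVecLin_apply, Matrix.mulVec, dotProduct, Pi.zero_apply] at this
      rw [hx, dgForm_sum_right, map_sum, ← this]
      refine Finset.sum_congr rfl fun j _ => ?_
      rw [map_smul, smul_eq_mul, mul_comm]
      rfl
    have h2 : ∀ y, Algebra.trace (ZMod 2) K (dgForm z y x) = 0 := by
      intro y
      rw [← e.sum_repr y, dgForm_comm, dgForm_sum_right, map_sum]
      refine Finset.sum_eq_zero fun j _ => ?_
      rw [map_smul, dgForm_comm, h1, smul_zero]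
    rw [Multiset.mem_toFinset, Polynomial.mem_roots hq0, Polynomial.IsRoot.def]
    refine (traceForm_nondegenerate (ZMod 2) K).1 _ fun w => ?_
    obtain ⟨y, rfl⟩ : ∃ y : K, y ^ 2 ^ r = w := by
      obtain ⟨y, hy⟩ := (bijective_iterateFrobenius (R := K) (p := 2) (n := r)).2 w
      exact ⟨y, by rw [← hy, iterateFrobenius_def]⟩
    rw [Algebra.traceForm_apply, ← h2 y, trace_dgForm]
    simp [q, Polynomial.eval_finsetSum]
  have hinj2 : Function.Injective (fun v : LinearMap.ker (dgMatrix e r z).mulVecLin =>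
      (⟨_, hroot v⟩ : (q.roots.toFinset : Finset K))) := by
    intro v w h
    have h' : e.equivFun.symm v.1 = e.equivFun.symm w.1 := by
      simpa [Module.Basis.equivFun_symm_apply] using h
    exact Subtype.ext (e.equivFun.symm.injective h')
  calc _ ≤ Nat.card (q.roots.toFinset : Finset K) := Nat.card_le_card_of_injective _ hinj2
    _ = q.roots.toFinset.card := Nat.card_eq_fintype_card.trans (Fintype.card_coe _)
    _ ≤ q.roots.card := Multiset.toFinset_card_le _
    _ ≤ q.natDegree := q.card_roots'
    _ ≤ _ := hdeg

theorem dgMatrix_rank {K : Type*} [Field K] [Finite K] [Algebra (ZMod 2) K] {m : ℕ}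
    (e : Module.Basis (Fin m) (ZMod 2) K) (r : ℕ) (z : Fin (r + 1) → K) (hz : z ≠ 0) :
    m ≤ (dgMatrix e r z).rank + 2 * r := by
  have h := dgMatrix_ker_card e r z hz
  rw [Module.natCard_eq_pow_finrank (K := ZMod 2), Nat.card_zmod] at h
  have h1 := (Nat.pow_le_pow_iff_right (by norm_num)).1 h
  have h2 := (dgMatrix e r z).mulVecLin.finrank_range_add_finrank_ker
  rw [Module.finrank_fin_fun] at h2
  change (dgMatrix e r z).rank + _ = m at h2
  omega

/-- The classical trace construction satisfies the definition of a Delsarte–Goethals set. -/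
theorem isDelsarteGoethals_dgTraceSpace {K : Type*} [Field K] [Finite K] [Algebra (ZMod 2) K]
    {m r : ℕ} (hr : 2 * r < m) (e : Module.Basis (Fin m) (ZMod 2) K) :
    IsDelsarteGoethals m r (dgTraceSpace e r) where
  symm := by
    rintro _ ⟨z, rfl⟩
    ext i j
    exact congrArg (Algebra.trace (ZMod 2) K) (dgForm_comm z (e j) (e i))
  card := by
    have hinj : Function.Injective (dgMatrix e r) := by
      rw [← LinearMap.ker_eq_bot, LinearMap.ker_eq_bot']
      intro z hz
      by_contra h0
      have := dgMatrix_rank e r z h0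
      rw [hz, Matrix.rank_zero] at this
      omega
    have hK : Nat.card K = 2 ^ m := by
      rw [Nat.card_congr e.equivFun.toEquiv]
      simp
    rw [dgTraceSpace, ← Nat.card_congr (LinearEquiv.ofInjective (dgMatrix e r) hinj).toEquiv, Nat.card_fun, hK,
      Nat.card_fin, ← pow_mul, mul_comm]
  rank := by
    rintro _ ⟨z, rfl⟩ _ ⟨w, rfl⟩ h
    rw [← map_sub]
    exact dgMatrix_rank e r _ fun h0 => h (by rw [sub_eq_zero.1 h0])

/-- Delsarte–Goethals sets exist for all parameters `m > 2r`. -/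
theorem exists_isDelsarteGoethals {m r : ℕ} (hr : 2 * r < m) :
    ∃ D : Submodule (ZMod 2) (BinMat m), IsDelsarteGoethals m r D :=
  ⟨_, isDelsarteGoethals_dgTraceSpace hr
    (Module.finBasisOfFinrankEq (ZMod 2) (GaloisField 2 m) (GaloisField.finrank 2 (by omega)))⟩

end Existence

/-- `x yᵀ`, computed in the nonnegative integers from the lifts of the entries to `{0, 1}`. -/
def liftDot {m : ℕ} (x y : BinVec m) : ℕ := ∑ i, (x i).val * (y i).val

/-- `x P xᵀ`, computed in the nonnegative integers from the lifts of the entries to `{0, 1}`. -/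
def liftQuad {m : ℕ} (P : BinMat m) (x : BinVec m) : ℕ :=
  ∑ i, ∑ j, (x i).val * (P i j).val * (x j).val

/-- The entry `φ_{P,b}(x) = i^(wt(d_P) + 2 wt(b)) i^(x P xᵀ + 2 b xᵀ)`, with `d_P` the diagonal
of `P` and `wt` the Hamming weight. -/
noncomputable def chirp {m : ℕ} (P : BinMat m) (b x : BinVec m) : ℂ :=
  Complex.I ^ (hammingNorm P.diag + 2 * hammingNorm b) *
    Complex.I ^ (liftQuad P x + 2 * liftDot b x)

/-- The sensing matrix of a set `D` of binary matrices, its columns `φ_{P,b}`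
(`P ∈ D`, `b` a binary `m`-tuple) being numbered by `col`. -/
noncomputable def sensingMatrix {m C : ℕ} {D : Submodule (ZMod 2) (BinMat m)}
    (col : Fin C ≃ D × BinVec m) : Matrix (BinVec m) (Fin C) ℂ :=
  Matrix.of fun x c => chirp (col c).1.1 (col c).2 x

/-- `h(s, t) = ∑_x (-1)^(ℓ xᵀ) Φ(x + a, s) conj Φ(x, t)` for columns `s`, `t` of `Φ`. -/
noncomputable def crossCorr {m C : ℕ} (Φ : Matrix (BinVec m) (Fin C) ℂ) (a l : BinVec m)
    (s t : Fin C) : ℂ :=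
  ∑ x : BinVec m, (-1) ^ liftDot l x * Φ (x + a) s * starRingEnd ℂ (Φ x t)

/-- `Γ_a^ℓ(t₁, …, t_k) = N^(-3/2) ∑_{i ≠ j} α_i conj(α_j) h(t_i, t_j)`, with `N = 2^m`. -/
noncomputable def crossTerm {m C k : ℕ} (Φ : Matrix (BinVec m) (Fin C) ℂ) (a l : BinVec m)
    (α : EuclideanSpace ℂ (Fin k)) (t : Fin k → Fin C) : ℂ :=
  (((2 ^ m : ℝ) ^ (-(3 / 2) : ℝ) : ℝ) : ℂ) *
    ∑ i, ∑ j, if i ≠ j then α i * starRingEnd ℂ (α j) * crossCorr Φ a l (t i) (t j) else 0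

/-! Write `M = 2^r/N`, `κ = N^(-1/2)`, `L = log (N/δ)`, and let `ε² = 8kLM` be the square of the
factor in the claimed bound. The pairs of columns in the cross term are split according to whether
their matrices agree.

If the matrices agree, the quadratic phases cancel and the correlation is a character sum, nonzero
only for one partner of each column (`chirpCorr_eq_zero`). This part is a weighted matching, so it
is at most `κ‖α‖²` for every permutation (`norm_sum_sameCorr_le`).

If they differ, the rank condition bounds each normalised correlation by `M`
(`norm_sq_distinctCorr_le`). These correlations form a matrix that is Hermitian or skew-Hermitian,
according to the sign `(-1)^(ℓaᵀ)`, and its entries sum to zero because `a ≠ 0`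
(`sum_sum_chirpCorr_eq_zero`). The remaining part is thus, up to a fixed unit factor, a centred real
function of the random permutation.

Concentration comes from the martingale that reveals the permutation value by value, with the
coefficients sorted by decreasing modulus. A transposition of position `i` with a later one then
moves the form by at most `8‖αᵢ‖‖α‖R`, where `R` bounds the `ℓ²`-norm of a row on `k` columns
(`norm_permForm_mul_swap_sub_le`). The squares add up to `64R²‖α‖⁴`, which yields the tail `2
exp(-x²/(32R²))` (`SparseRowBound.card_le_norm_permForm`); a union bound over the `N` values of `ℓ`
finishes.

With `R² = kM²` and `x = ε - κ` the exponent is roughly `L/(4M)`, which suffices once `M ≤ 1/8`; for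
very small `k` the deterministic bound `kM + κ ≤ ε` is used instead. Only `(m,r) = (1,0)` and
`(3,1)` have `M > 1/8`. In the first `k ≤ 4`, and the deterministic bound works. In the second the
exponent is barely too small, and `R` is improved by counting the matrices at distance at most one
in rank and applying Parseval (`sparseRowBound_distinctCorr_three`). -/

/-! ### Concentration for uniformly random permutations. -/

/-- Hoeffding's lemma for the uniform distribution on a finite type. -/
theorem sum_exp_le_of_abs_sub_le {ι : Type*} [Fintype ι] [Nonempty ι] (g : ι → ℝ) (c lam : ℝ)
    (hg : ∀ p q, |g p - g q| ≤ c) :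
    ∑ p, Real.exp (lam * g p) ≤ Fintype.card ι *
      Real.exp (lam * ((∑ p, g p) / Fintype.card ι) + lam ^ 2 / 8 * c ^ 2) := by
  classical
  let _ : MeasurableSpace ι := ⊤
  have hc : 0 ≤ c := (abs_nonneg _).trans (hg (Classical.arbitrary ι) (Classical.arbitrary ι))
  obtain ⟨p₀, hp₀⟩ := Finite.exists_min g
  have hn : (0 : ℝ) < Fintype.card ι := by exact_mod_cast Fintype.card_pos
  set μ := (PMF.uniformOfFintype ι).toMeasure
  have hint : ∀ f : ι → ℝ, ∫ x, f x ∂μ = (∑ p, f p) / Fintype.card ι := by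
    intro f
    rw [PMF.integral_eq_sum]
    simp [← Finset.mul_sum, div_eq_inv_mul]
  have h := (ProbabilityTheory.hasSubgaussianMGF_of_mem_Icc (μ := μ) (X := g)
    (a := g p₀) (b := g p₀ + c) (measurable_from_top.aemeasurable)
    (Filter.Eventually.of_forall fun p => ⟨hp₀ p, by
      linarith [(abs_le.1 (hg p p₀)).2]⟩)).mgf_le lam
  rw [ProbabilityTheory.mgf, hint, hint] at h
  have h2 : ∑ p, Real.exp (lam * g p) = Real.exp (lam * ((∑ p, g p) / Fintype.card ι)) *
      ∑ p, Real.exp (lam * (g p - (∑ p, g p) / Fintype.card ι)) := by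
    rw [Finset.mul_sum]
    refine Finset.sum_congr rfl fun p _ => ?_
    rw [← Real.exp_add]
    ring_nf
  rw [h2, Real.exp_add, mul_left_comm]
  refine mul_le_mul_of_nonneg_left ?_ (Real.exp_nonneg _)
  rw [div_le_iff₀ hn] at h
  rw [mul_comm]
  refine h.trans (le_of_eq ?_)
  congr 2
  simp only [add_sub_cancel_left, NNReal.coe_pow, NNReal.coe_div, coe_nnnorm, Real.norm_eq_abs,
    NNReal.coe_ofNat, abs_of_nonneg hc]
  ring

/-- Fixing the value at `0` leaves a permutation of the other positions, and transpositions of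
positions are compatible with this; it lets the martingale argument run by induction on `n`. -/
theorem decomposeFin_symm_mul_swap {n : ℕ} (p : Fin (n + 1)) (e : Equiv.Perm (Fin n))
    (i j : Fin n) :
    Equiv.Perm.decomposeFin.symm (p, e * Equiv.swap i j) =
      Equiv.Perm.decomposeFin.symm (p, e) * Equiv.swap i.succ j.succ := by
  ext x
  refine Fin.cases ?_ (fun x => ?_) x
  · rw [Equiv.Perm.mul_apply, Equiv.swap_apply_of_ne_of_ne (Fin.succ_ne_zero _).symm
      (Fin.succ_ne_zero _).symm]
    simp
  · rw [Equiv.Perm.mul_apply, ← (Fin.succ_injective n).map_swap]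
    simp

/-- The sums of `f` over the permutations with prescribed values at `0`
differ by little if `f` has small differences under transpositions. -/
theorem abs_sum_decomposeFin_sub_le {n : ℕ} (f : Equiv.Perm (Fin (n + 1)) → ℝ) (c : ℝ)
    (hc : 0 ≤ c) (hf : ∀ π, ∀ j, 0 < j → |f (π * Equiv.swap 0 j) - f π| ≤ c)
    (p q : Fin (n + 1)) :
    |∑ e, f (Equiv.Perm.decomposeFin.symm (p, e)) - ∑ e, f (Equiv.Perm.decomposeFin.symm (q, e))|
      ≤ n.factorial * c := by
  have key : ∀ (F : Equiv.Perm (Fin (n + 1)) → ℝ) (p : Fin (n + 1)),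
      ∑ e, F (Equiv.Perm.decomposeFin.symm (p, e)) = ∑ π, if π 0 = p then F π else 0 := by
    intro F p
    rw [← Equiv.sum_comp Equiv.Perm.decomposeFin.symm, Fintype.sum_prod_type,
      Finset.sum_eq_single p]
    · simp
    · intro b _ hb
      simp [hb]
    · simp
  -- Left multiplication by `swap p q` matches the permutations with value `p` at `0` with those
  -- with value `q` there.
  have hq : ∑ e, f (Equiv.Perm.decomposeFin.symm (q, e)) =
      ∑ e, f (Equiv.swap p q * Equiv.Perm.decomposeFin.symm (p, e)) := by
    rw [key, key (fun π => f (Equiv.swap p q * π)), ← Equiv.sum_comp (Equiv.mulLeft (Equiv.swap p q))]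
    refine Finset.sum_congr rfl fun π _ => ?_
    have : (Equiv.swap p q * π) 0 = q ↔ π 0 = p := by
      rw [Equiv.Perm.mul_apply, Equiv.swap_apply_eq_iff, Equiv.swap_apply_right]
    simp only [Equiv.coe_mulLeft, this]
  rw [hq, ← Finset.sum_sub_distrib]
  refine (Finset.abs_sum_le_sum_abs _ _).trans ?_
  have : ∀ e ∈ (Finset.univ : Finset (Equiv.Perm (Fin n))),
      |f (Equiv.Perm.decomposeFin.symm (p, e)) -
        f (Equiv.swap p q * Equiv.Perm.decomposeFin.symm (p, e))| ≤ c := by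
    intro e _
    set π := Equiv.Perm.decomposeFin.symm (p, e) with hπ
    have h0 : π⁻¹ p = 0 := by
      rw [Equiv.Perm.inv_eq_iff_eq, hπ, Equiv.Perm.decomposeFin_symm_apply_zero]
    -- Swapping the values `p` and `q` is swapping the positions `0` and `π⁻¹ q`, so the hypothesis
    -- on transpositions of positions applies.
    rw [Equiv.swap_mul_eq_mul_swap, h0, abs_sub_comm]
    rcases eq_or_ne (π⁻¹ q) 0 with h | h
    · rw [h, Equiv.swap_self]
      simpa [← Equiv.Perm.one_def] using hc
    · exact hf π _ (Fin.pos_of_ne_zero h)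
  refine (Finset.sum_le_card_nsmul _ _ _ this).trans (le_of_eq ?_)
  rw [Finset.card_univ, Fintype.card_perm, Fintype.card_fin, nsmul_eq_mul]

/-- The Azuma–Hoeffding inequality for uniformly random permutations, for the martingale that
reveals the values of the permutation one after the other. -/
theorem sum_exp_perm_le : ∀ {n : ℕ} (f : Equiv.Perm (Fin n) → ℝ) (c : Fin n → ℝ) (lam : ℝ)
    (_ : ∀ i, 0 ≤ c i) (_ : ∀ π, ∀ i j, i < j → |f (π * Equiv.swap i j) - f π| ≤ c i),
    ∑ π, Real.exp (lam * f π) ≤ n.factorial *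
      Real.exp (lam * ((∑ π, f π) / n.factorial) + lam ^ 2 / 8 * ∑ i, c i ^ 2)
  | 0, f, c, lam, _, _ => by simp
  | n + 1, f, c, lam, hc, hf => by
    have hn : (0 : ℝ) < n.factorial := by exact_mod_cast n.factorial_pos
    -- `G p` is the conditional mean of `f` given `π 0 = p`, the first step of the martingale.
    set G : Fin (n + 1) → ℝ := fun p =>
      (∑ e, f (Equiv.Perm.decomposeFin.symm (p, e))) / n.factorial with hG
    have ih : ∀ p, ∑ e, Real.exp (lam * f (Equiv.Perm.decomposeFin.symm (p, e))) ≤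
        n.factorial * Real.exp (lam * G p + lam ^ 2 / 8 * ∑ i : Fin n, c i.succ ^ 2) := by
      intro p
      refine sum_exp_perm_le (fun e => f (Equiv.Perm.decomposeFin.symm (p, e)))
        (fun i => c i.succ) lam (fun i => hc _) fun π i j hij => ?_
      rw [decomposeFin_symm_mul_swap]
      exact hf _ _ _ (Fin.succ_lt_succ_iff.2 hij)
    have hGc : ∀ p q, |G p - G q| ≤ c 0 := by
      intro p q
      rw [hG, ← sub_div, abs_div, abs_of_pos hn, div_le_iff₀ hn, mul_comm]
      exact abs_sum_decomposeFin_sub_le f (c 0) (hc 0) (fun π j hj => hf π 0 j hj) p q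
    have hsum : ∀ F : Equiv.Perm (Fin (n + 1)) → ℝ,
        ∑ π, F π = ∑ p, ∑ e, F (Equiv.Perm.decomposeFin.symm (p, e)) := by
      intro F
      rw [← Equiv.sum_comp Equiv.Perm.decomposeFin.symm, Fintype.sum_prod_type]
    have hmean : (∑ p, G p) / (Fintype.card (Fin (n + 1)) : ℝ) =
        (∑ π, f π) / (n + 1).factorial := by
      rw [hG, ← Finset.sum_div, hsum f, Nat.factorial_succ, Fintype.card_fin]
      push_cast
      field_simp
    have h2 := sum_exp_le_of_abs_sub_le G (c 0) lam hGc
    rw [hmean] at h2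
    calc ∑ π, Real.exp (lam * f π)
        ≤ ∑ p, n.factorial * Real.exp (lam * G p + lam ^ 2 / 8 * ∑ i : Fin n, c i.succ ^ 2) := by
          rw [hsum]
          exact Finset.sum_le_sum fun p _ => ih p
      _ = n.factorial * Real.exp (lam ^ 2 / 8 * ∑ i : Fin n, c i.succ ^ 2) *
            ∑ p, Real.exp (lam * G p) := by
          rw [Finset.mul_sum Finset.univ fun p => Real.exp (lam * G p)]
          refine Finset.sum_congr rfl fun p _ => ?_
          rw [Real.exp_add]
          ring
      _ ≤ n.factorial * Real.exp (lam ^ 2 / 8 * ∑ i : Fin n, c i.succ ^ 2) *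
            (Fintype.card (Fin (n + 1)) * Real.exp (lam * ((∑ π, f π) / (n + 1).factorial) +
              lam ^ 2 / 8 * c 0 ^ 2)) :=
          mul_le_mul_of_nonneg_left h2 (by positivity)
      _ = _ := by
          rw [Fin.sum_univ_succ, Nat.factorial_succ, Fintype.card_fin, mul_add, ← add_assoc,
            Real.exp_add (_ + _) (lam ^ 2 / 8 * ∑ i : Fin n, c i.succ ^ 2)]
          push_cast
          ring

/-- One-sided tail bound for centred functions of a uniformly random permutation. -/
theorem card_perm_le_of_swap {n : ℕ} (f : Equiv.Perm (Fin n) → ℝ) (c : Fin n → ℝ) (x S : ℝ)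
    (hc : ∀ i, 0 ≤ c i) (hf : ∀ π, ∀ i j, i < j → |f (π * Equiv.swap i j) - f π| ≤ c i)
    (hmean : ∑ π, f π = 0) (hx : 0 ≤ x) (hS : 0 < S) (hcS : ∑ i, c i ^ 2 ≤ S) :
    ((Finset.univ.filter fun π => x ≤ f π).card : ℝ) ≤
      n.factorial * Real.exp (-(2 * x ^ 2 / S)) := by
  -- The minimiser of `lam² S / 8 - lam x`, the exponent in the Chernoff bound.
  set lam : ℝ := 4 * x / S with hlam
  have hlam0 : 0 ≤ lam := by positivity
  have h := sum_exp_perm_le f c lam hc hf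
  rw [hmean, zero_div, mul_zero, zero_add] at h
  have h1 : ((Finset.univ.filter fun π => x ≤ f π).card : ℝ) * Real.exp (lam * x) ≤
      ∑ π, Real.exp (lam * f π) := by
    rw [← nsmul_eq_mul]
    refine (Finset.card_nsmul_le_sum _ (fun π => Real.exp (lam * f π)) _ ?_).trans
      (Finset.sum_le_sum_of_subset_of_nonneg (Finset.filter_subset _ _)
        fun _ _ _ => Real.exp_nonneg _)
    intro π hπ
    exact Real.exp_le_exp.2 (mul_le_mul_of_nonneg_left (Finset.mem_filter.1 hπ).2 hlam0)
  have h2 : Real.exp (lam ^ 2 / 8 * ∑ i, c i ^ 2) ≤ Real.exp (lam ^ 2 / 8 * S) :=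
    Real.exp_le_exp.2 (mul_le_mul_of_nonneg_left hcS (by positivity))
  have h3 : -(2 * x ^ 2 / S) = lam ^ 2 / 8 * S - lam * x := by
    rw [hlam]
    field_simp
    ring
  rw [h3, Real.exp_sub, ← mul_div_assoc, le_div_iff₀ (Real.exp_pos _)]
  exact h1.trans (h.trans (mul_le_mul_of_nonneg_left h2 (by positivity)))

/-! ### Quadratic forms evaluated at a random permutation. -/

/-- The quadratic form `∑ α_a conj(α_b) B(π a, π b)` evaluated at a permutation. -/
noncomputable def permForm {n : ℕ} (B : Fin n → Fin n → ℂ) (α : Fin n → ℂ)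
    (π : Equiv.Perm (Fin n)) : ℂ :=
  ∑ a, ∑ b, α a * starRingEnd ℂ (α b) * B (π a) (π b)

/-- Permuting positions amounts to permuting coefficients. This turns a transposition into a change
of two coefficients, and later allows sorting them. -/
theorem permForm_mul {n : ℕ} (B : Fin n → Fin n → ℂ) (α : Fin n → ℂ)
    (π σ : Equiv.Perm (Fin n)) : permForm B α (π * σ) = permForm B (α ∘ σ.symm) π := by
  simp only [permForm, ← Equiv.sum_comp σ (fun a => ∑ b, (α ∘ σ.symm) a *
    starRingEnd ℂ ((α ∘ σ.symm) b) * B (π a) (π b))]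
  refine Finset.sum_congr rfl fun a _ => ?_
  rw [← Equiv.sum_comp σ (fun b => (α ∘ σ.symm) (σ a) * starRingEnd ℂ ((α ∘ σ.symm) b) *
    B (π (σ a)) (π b))]
  simp

/-- Cauchy–Schwarz on the support of `β`, which has at most `k` elements. -/
theorem norm_sum_mul_le_of_sparse {ι : Type*} [Fintype ι] {k : ℕ} {R : ℝ} (hR : 0 ≤ R)
    (β w : ι → ℂ) (hβ : (Finset.univ.filter fun a => β a ≠ 0).card ≤ k)
    (hw : ∀ T : Finset ι, T.card ≤ k → ∑ t ∈ T, ‖w t‖ ^ 2 ≤ R ^ 2) :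
    ‖∑ b, β b * w b‖ ≤ √(∑ b, ‖β b‖ ^ 2) * R := by
  have h1 : ∑ b, β b * w b = ∑ b ∈ Finset.univ.filter fun a => β a ≠ 0, β b * w b := by
    refine (Finset.sum_filter_of_ne fun b _ h => ?_).symm
    exact left_ne_zero_of_mul h
  rw [h1]
  calc _ ≤ ∑ b ∈ Finset.univ.filter fun a => β a ≠ 0, ‖β b‖ * ‖w b‖ := by
        refine (norm_sum_le _ _).trans (le_of_eq ?_)
        simp only [norm_mul]
    _ ≤ √(∑ b ∈ Finset.univ.filter fun a => β a ≠ 0, ‖β b‖ ^ 2) *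
          √(∑ b ∈ Finset.univ.filter fun a => β a ≠ 0, ‖w b‖ ^ 2) :=
        Real.sum_mul_le_sqrt_mul_sqrt _ _ _
    _ ≤ √(∑ b, ‖β b‖ ^ 2) * R := by
        refine mul_le_mul (Real.sqrt_le_sqrt ?_) ((Real.sqrt_le_left hR).2 (hw _ hβ))
          (Real.sqrt_nonneg _) (Real.sqrt_nonneg _)
        exact Finset.sum_le_sum_of_subset_of_nonneg (Finset.filter_subset _ _)
          fun _ _ _ => by positivity

theorem sum_norm_le_of_sparse {ι : Type*} [Fintype ι] {k : ℕ}
    (β : ι → ℂ) (hβ : (Finset.univ.filter fun a => β a ≠ 0).card ≤ k) :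
    ∑ b, ‖β b‖ ≤ √(∑ b, ‖β b‖ ^ 2) * √k := by
  have h := norm_sum_mul_le_of_sparse (Real.sqrt_nonneg k) (fun b => (‖β b‖ : ℂ)) (fun _ => 1)
    (by simpa using hβ) (fun T hT => by
      rw [Real.sq_sqrt (Nat.cast_nonneg k)]
      simpa using hT)
  simp only [mul_one, Complex.norm_real, norm_norm, ← Complex.ofReal_sum] at h
  rwa [Real.norm_of_nonneg (Finset.sum_nonneg fun _ _ => norm_nonneg _)] at h

/-- `B` is Hermitian or skew-Hermitian, and every row has `ℓ²`-norm at most `R` on every set of at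
most `k` columns. -/
structure SparseRowBound {n : ℕ} (k : ℕ) (R : ℝ) (B : Fin n → Fin n → ℂ) : Prop where
  nonneg : 0 ≤ R
  herm : (∀ s t, B t s = starRingEnd ℂ (B s t)) ∨ (∀ s t, B t s = -starRingEnd ℂ (B s t))
  row : ∀ s, ∀ T : Finset (Fin n), T.card ≤ k → ∑ t ∈ T, ‖B s t‖ ^ 2 ≤ R ^ 2

namespace SparseRowBound

variable {n k : ℕ} {R : ℝ} {B : Fin n → Fin n → ℂ}

theorem norm_symm (hB : SparseRowBound k R B) (s t : Fin n) : ‖B t s‖ = ‖B s t‖ := by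
  rcases hB.herm with h | h <;> simp [h s t]

theorem row_perm (hB : SparseRowBound k R B) (π : Equiv.Perm (Fin n)) (s : Fin n)
    (T : Finset (Fin n)) (hT : T.card ≤ k) : ∑ t ∈ T, ‖B s (π t)‖ ^ 2 ≤ R ^ 2 := by
  have := hB.row s (T.map π.toEmbedding) (by simpa using hT)
  simpa using this

theorem norm_row_le (hB : SparseRowBound k R B) (α : Fin n → ℂ)
    (hα : (Finset.univ.filter fun a => α a ≠ 0).card ≤ k) (π : Equiv.Perm (Fin n)) (s : Fin n) :
    ‖∑ b, starRingEnd ℂ (α b) * B s (π b)‖ ≤ √(∑ b, ‖α b‖ ^ 2) * R := by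
  have := norm_sum_mul_le_of_sparse hB.nonneg (fun b => starRingEnd ℂ (α b)) (fun b => B s (π b))
    (by simpa using hα) (hB.row_perm π s)
  simpa using this

theorem norm_col_le (hB : SparseRowBound k R B) (α : Fin n → ℂ)
    (hα : (Finset.univ.filter fun a => α a ≠ 0).card ≤ k) (π : Equiv.Perm (Fin n)) (s : Fin n) :
    ‖∑ b, α b * B (π b) s‖ ≤ √(∑ b, ‖α b‖ ^ 2) * R :=
  norm_sum_mul_le_of_sparse hB.nonneg α (fun b => B (π b) s) hα fun T hT => by
    simpa only [hB.norm_symm s] using hB.row_perm π s T hT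

/-- Each row sum is at most `√A * R` with `A = ∑ ‖α b‖²`, and sparsity gives `∑ ‖α a‖ ≤ √(k A)`.
This bound holds for every permutation and settles small `k`. -/
theorem norm_permForm_le (hB : SparseRowBound k R B) (α : Fin n → ℂ)
    (hα : (Finset.univ.filter fun a => α a ≠ 0).card ≤ k) (π : Equiv.Perm (Fin n)) :
    ‖permForm B α π‖ ≤ √k * R * ∑ b, ‖α b‖ ^ 2 := by
  have hA : 0 ≤ ∑ b, ‖α b‖ ^ 2 := Finset.sum_nonneg fun _ _ => by positivity
  calc ‖permForm B α π‖ = ‖∑ a, α a * ∑ b, starRingEnd ℂ (α b) * B (π a) (π b)‖ := by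
        simp only [permForm, Finset.mul_sum, mul_assoc]
    _ ≤ ∑ a, ‖α a‖ * (√(∑ b, ‖α b‖ ^ 2) * R) := by
        refine (norm_sum_le _ _).trans (Finset.sum_le_sum fun a _ => ?_)
        rw [norm_mul]
        exact mul_le_mul_of_nonneg_left (hB.norm_row_le α hα π _) (norm_nonneg _)
    _ ≤ (√(∑ b, ‖α b‖ ^ 2) * √k) * (√(∑ b, ‖α b‖ ^ 2) * R) := by
        rw [← Finset.sum_mul]
        exact mul_le_mul_of_nonneg_right (sum_norm_le_of_sparse α hα)
          (mul_nonneg (Real.sqrt_nonneg _) hB.nonneg)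
    _ = (√(∑ b, ‖α b‖ ^ 2) * √(∑ b, ‖α b‖ ^ 2)) * (√k * R) := by ring
    _ = _ := by rw [Real.mul_self_sqrt hA]; ring

/-- The coefficients change only at `i` and `j`, each by at most `2 * ‖α i‖`. Changing the two
factors of the form one at a time costs `4 * ‖α i‖` times a row or column bound each time. -/
theorem norm_permForm_mul_swap_sub_le (hB : SparseRowBound k R B) (α : Fin n → ℂ)
    (hα : (Finset.univ.filter fun a => α a ≠ 0).card ≤ k) (π : Equiv.Perm (Fin n))
    {i j : Fin n} (hij : i ≠ j) (h : ‖α j‖ ≤ ‖α i‖) :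
    ‖permForm B α (π * Equiv.swap i j) - permForm B α π‖ ≤
      8 * ‖α i‖ * (√(∑ b, ‖α b‖ ^ 2) * R) := by
  rw [permForm_mul, Equiv.symm_swap]
  set β := α ∘ Equiv.swap i j with hβ
  have hβs : ∑ b, ‖β b‖ ^ 2 = ∑ b, ‖α b‖ ^ 2 :=
    Equiv.sum_comp (Equiv.swap i j) (fun b => ‖α b‖ ^ 2)
  have hβk : (Finset.univ.filter fun a => β a ≠ 0).card ≤ k := by
    refine le_trans (le_of_eq ?_) hα
    refine Finset.card_bij (fun a _ => Equiv.swap i j a) (by simp [hβ])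
      (fun a _ b _ hab => (Equiv.swap i j).injective hab) fun b hb => ⟨Equiv.swap i j b, ?_, ?_⟩
    · simpa [hβ] using hb
    · simp
  have h0 : ∀ a, a ≠ i → a ≠ j → β a - α a = 0 := by
    intro a ha hb
    rw [hβ, Function.comp_apply, Equiv.swap_apply_of_ne_of_ne ha hb, sub_self]
  have hd : ‖α j - α i‖ ≤ 2 * ‖α i‖ := (norm_sub_le _ _).trans (by linarith)
  have hbi : ‖β i - α i‖ ≤ 2 * ‖α i‖ := by simpa [hβ] using hd
  have hbj : ‖β j - α j‖ ≤ 2 * ‖α i‖ := by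
    rw [norm_sub_rev] at hd
    simpa [hβ] using hd
  have hsum : ∀ (F : Fin n → ℂ) (M : ℝ), 0 ≤ M → (∀ a, ‖F a‖ ≤ M) →
      ‖∑ a, (β a - α a) * F a‖ ≤ 4 * ‖α i‖ * M := by
    intro F M hM hF
    rw [← Finset.sum_subset (Finset.subset_univ {i, j}), Finset.sum_pair hij]
    · refine (norm_add_le _ _).trans ?_
      rw [norm_mul, norm_mul]
      have h1 := mul_le_mul hbi (hF i) (norm_nonneg _) (by positivity)
      have h2 := mul_le_mul hbj (hF j) (norm_nonneg _) (by positivity)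
      linarith
    · intro a _ ha
      simp only [Finset.mem_insert, Finset.mem_singleton, not_or] at ha
      rw [h0 a ha.1 ha.2, zero_mul]
  have hM : 0 ≤ √(∑ b, ‖α b‖ ^ 2) * R := mul_nonneg (Real.sqrt_nonneg _) hB.nonneg
  have e : permForm B β π - permForm B α π =
      ∑ a, (β a - α a) * (∑ b, starRingEnd ℂ (β b) * B (π a) (π b)) +
        starRingEnd ℂ (∑ b, (β b - α b) * starRingEnd ℂ (∑ a, α a * B (π a) (π b))) := by
    simp only [map_sum, map_mul, map_sub, Complex.conj_conj, permForm, Finset.mul_sum]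
    rw [Finset.sum_comm (f := fun b a => (starRingEnd ℂ (β b) - starRingEnd ℂ (α b)) *
      (α a * B (π a) (π b))), ← Finset.sum_sub_distrib, ← Finset.sum_add_distrib]
    refine Finset.sum_congr rfl fun a _ => ?_
    rw [← Finset.sum_sub_distrib, ← Finset.sum_add_distrib]
    refine Finset.sum_congr rfl fun b _ => ?_
    ring
  rw [e]
  refine (norm_add_le _ _).trans ?_
  rw [RCLike.norm_conj]
  have h1 := hsum (fun a => ∑ b, starRingEnd ℂ (β b) * B (π a) (π b)) _ hM fun a => by
    rw [← hβs]
    exact hB.norm_row_le β hβk π _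
  have h2 := hsum (fun b => starRingEnd ℂ (∑ a, α a * B (π a) (π b))) _ hM fun b => by
    rw [RCLike.norm_conj]
    exact hB.norm_col_le α hα π _
  linarith

/-- A value of the form is determined, up to sign, by a fixed real-linear functional. -/
theorem exists_norm_permForm_eq (hB : SparseRowBound k R B) :
    ∃ u : ℂ, ‖u‖ = 1 ∧ ∀ α π, ‖permForm B α π‖ = |(u * permForm B α π).re| := by
  rcases hB.herm with h | h
  · refine ⟨1, norm_one, fun α π => ?_⟩
    have : starRingEnd ℂ (permForm B α π) = permForm B α π := by
      simp only [permForm, map_sum, map_mul, Complex.conj_conj, ← h]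
      rw [Finset.sum_comm]
      exact Finset.sum_congr rfl fun a _ => Finset.sum_congr rfl fun b _ => by ring
    rw [one_mul]
    conv_lhs => rw [← Complex.conj_eq_iff_re.1 this]
    rw [Complex.norm_real, Real.norm_eq_abs]
  · refine ⟨Complex.I, Complex.norm_I, fun α π => ?_⟩
    have : starRingEnd ℂ (permForm B α π) = -permForm B α π := by
      have h' : ∀ s t, starRingEnd ℂ (B s t) = -B t s := fun s t => by rw [h s t, neg_neg]
      simp only [permForm, map_sum, map_mul, Complex.conj_conj, h']
      rw [Finset.sum_comm, ← Finset.sum_neg_distrib]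
      refine Finset.sum_congr rfl fun a _ => ?_
      rw [← Finset.sum_neg_distrib]
      exact Finset.sum_congr rfl fun b _ => by ring
    have h2 : starRingEnd ℂ (Complex.I * permForm B α π) = Complex.I * permForm B α π := by
      rw [map_mul, this, Complex.conj_I, neg_mul_neg]
    rw [← Real.norm_eq_abs, ← Complex.norm_real, Complex.conj_eq_iff_re.1 h2, norm_mul,
      Complex.norm_I, one_mul]

end SparseRowBound

theorem exists_perm_apply_eq {ι : Type*} [DecidableEq ι] {a b a' b' : ι} (h : a ≠ b)
    (h' : a' ≠ b') : ∃ σ : Equiv.Perm ι, σ a = a' ∧ σ b = b' := by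
  refine ⟨Equiv.swap (Equiv.swap a a' b) b' * Equiv.swap a a', ?_, ?_⟩
  · rw [Equiv.Perm.mul_apply, Equiv.swap_apply_left]
    refine Equiv.swap_apply_of_ne_of_ne ?_ h'
    intro hc
    exact h ((Equiv.swap a a').injective (by rw [← hc, Equiv.swap_apply_left]))
  · rw [Equiv.Perm.mul_apply, Equiv.swap_apply_left]

/-- The images of two points under a random permutation are uniform on the pairs of distinct
points. -/
theorem sum_perm_apply_apply_eq_zero {n : ℕ} (B : Fin n → Fin n → ℂ) (h0 : ∀ s, B s s = 0)
    (hsum : ∑ s, ∑ t, B s t = 0) (a b : Fin n) :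
    ∑ π : Equiv.Perm (Fin n), B (π a) (π b) = 0 := by
  rcases eq_or_ne a b with rfl | hab
  · simp [h0]
  have hT : ∀ c d : Fin n, c ≠ d → ∑ π : Equiv.Perm (Fin n), B (π c) (π d) =
      ∑ π : Equiv.Perm (Fin n), B (π a) (π b) := by
    intro c d hcd
    -- The symmetric group is transitive on ordered pairs of distinct points, so the sum does not
    -- depend on the pair; the sum over all pairs vanishes by `hsum`.
    obtain ⟨σ, h1, h2⟩ := exists_perm_apply_eq hab hcd
    rw [← Equiv.sum_comp (Equiv.mulRight σ) (fun π => B (π a) (π b))]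
    simp [h1, h2]
  have htot : ∑ c, ∑ d, ∑ π : Equiv.Perm (Fin n), B (π c) (π d) = 0 := by
    rw [Finset.sum_congr rfl fun c _ => Finset.sum_comm, Finset.sum_comm]
    refine Finset.sum_eq_zero fun π _ => ?_
    rw [← hsum, ← Equiv.sum_comp π (fun s => ∑ t, B s t)]
    exact Finset.sum_congr rfl fun c _ => Equiv.sum_comp π (B (π c))
  have hval : ∀ c d : Fin n, ∑ π : Equiv.Perm (Fin n), B (π c) (π d) =
      if c ≠ d then ∑ π : Equiv.Perm (Fin n), B (π a) (π b) else 0 := by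
    intro c d
    split_ifs with h
    · exact hT c d h
    · rw [not_not] at h
      simp [h, h0]
  rw [Finset.sum_congr rfl fun c _ => Finset.sum_congr rfl fun d _ => hval c d] at htot
  simp only [← Finset.sum_filter, Finset.sum_const, nsmul_eq_mul, ← Finset.sum_mul] at htot
  refine (mul_eq_zero.1 htot).resolve_left ?_
  rw [← Nat.cast_sum]
  refine Nat.cast_ne_zero.2 ?_
  have : 0 < (Finset.univ.filter fun d => a ≠ d).card :=
    Finset.card_pos.2 ⟨b, by simpa using hab⟩
  exact (this.trans_le (Finset.single_le_sum (f := fun c =>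
    (Finset.univ.filter fun d => c ≠ d).card) (fun _ _ => Nat.zero_le _) (Finset.mem_univ a))).ne'

theorem sum_permForm_eq_zero {n : ℕ} (B : Fin n → Fin n → ℂ) (h0 : ∀ s, B s s = 0)
    (hsum : ∑ s, ∑ t, B s t = 0) (α : Fin n → ℂ) : ∑ π, permForm B α π = 0 := by
  simp only [permForm]
  rw [Finset.sum_comm]
  refine Finset.sum_eq_zero fun a _ => ?_
  rw [Finset.sum_comm]
  refine Finset.sum_eq_zero fun b _ => ?_
  rw [← Finset.mul_sum, sum_perm_apply_apply_eq_zero B h0 hsum, mul_zero]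

/-- Two-sided tail bound for the quadratic form with coefficients of decreasing modulus. -/
theorem SparseRowBound.card_le_norm_permForm_of_antitone {n k : ℕ} {R : ℝ}
    {B : Fin n → Fin n → ℂ} (hB : SparseRowBound k R B) (hR : 0 < R) (h0 : ∀ s, B s s = 0)
    (hsum : ∑ s, ∑ t, B s t = 0) (α : Fin n → ℂ)
    (hα : (Finset.univ.filter fun a => α a ≠ 0).card ≤ k) (hanti : Antitone fun a => ‖α a‖)
    (hA : 0 < ∑ a, ‖α a‖ ^ 2) {x : ℝ} (hx : 0 ≤ x) :
    ((Finset.univ.filter fun π => x * ∑ a, ‖α a‖ ^ 2 ≤ ‖permForm B α π‖).card : ℝ) ≤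
      n.factorial * (2 * Real.exp (-(x ^ 2 / (32 * R ^ 2)))) := by
  set A := ∑ a, ‖α a‖ ^ 2 with hAdef
  obtain ⟨u, hu, hre⟩ := hB.exists_norm_permForm_eq
  have tail : ∀ v : ℂ, ‖v‖ = 1 →
      ((Finset.univ.filter fun π => x * A ≤ (v * permForm B α π).re).card : ℝ) ≤
        n.factorial * Real.exp (-(x ^ 2 / (32 * R ^ 2))) := by
    intro v hv
    -- Since the moduli decrease, the increment at step `i` involves `‖α i‖` only; the squared
    -- increments sum to `64 * R ^ 2 * A ^ 2`.
    have h := card_perm_le_of_swap (fun π => (v * permForm B α π).re)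
      (fun i => 8 * ‖α i‖ * (√A * R)) (x * A) (64 * R ^ 2 * A ^ 2)
      (fun i => by have := hB.nonneg; positivity) (fun π i j hij => by
        rw [← Complex.sub_re, ← mul_sub]
        refine (Complex.abs_re_le_norm _).trans ?_
        rw [norm_mul, hv, one_mul]
        exact hB.norm_permForm_mul_swap_sub_le α hα π hij.ne (hanti hij.le))
      (by rw [← Complex.re_sum, ← Finset.mul_sum, sum_permForm_eq_zero B h0 hsum, mul_zero,
        Complex.zero_re]) (by positivity) (by positivity) (le_of_eq (by
          simp only [mul_pow, Real.sq_sqrt hA.le]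
          rw [← Finset.sum_mul, ← Finset.mul_sum, ← hAdef]
          ring))
    refine h.trans (le_of_eq ?_)
    congr 3
    field_simp
    ring
  have h1 := tail u hu
  have h2 := tail (-u) (by rw [norm_neg, hu])
  have hsub : (Finset.univ.filter fun π => x * A ≤ ‖permForm B α π‖) ⊆
      (Finset.univ.filter fun π => x * A ≤ (u * permForm B α π).re) ∪
        (Finset.univ.filter fun π => x * A ≤ (-u * permForm B α π).re) := by
    intro π hπ
    simp only [Finset.mem_filter, Finset.mem_univ, true_and, hre, le_abs] at hπ
    simpa using hπ
  have h3 : ((Finset.univ.filter fun π => x * A ≤ ‖permForm B α π‖).card : ℝ) ≤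
      (Finset.univ.filter fun π => x * A ≤ (u * permForm B α π).re).card +
        (Finset.univ.filter fun π => x * A ≤ (-u * permForm B α π).re).card := by
    exact_mod_cast (Finset.card_le_card hsub).trans (Finset.card_union_le _ _)
  linarith

/-- Two-sided tail bound for the quadratic form of a uniformly random permutation. -/
theorem SparseRowBound.card_le_norm_permForm {n k : ℕ} {R : ℝ}
    {B : Fin n → Fin n → ℂ} (hB : SparseRowBound k R B) (hR : 0 < R) (h0 : ∀ s, B s s = 0)
    (hsum : ∑ s, ∑ t, B s t = 0) (α : Fin n → ℂ)
    (hα : (Finset.univ.filter fun a => α a ≠ 0).card ≤ k)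
    (hA : 0 < ∑ a, ‖α a‖ ^ 2) {x : ℝ} (hx : 0 ≤ x) :
    ((Finset.univ.filter fun π => x * ∑ a, ‖α a‖ ^ 2 ≤ ‖permForm B α π‖).card : ℝ) ≤
      n.factorial * (2 * Real.exp (-(x ^ 2 / (32 * R ^ 2)))) := by
  set σ := Tuple.sort fun a => -‖α a‖ with hσ
  have hanti : Antitone fun a => ‖(α ∘ σ) a‖ := by
    intro a b hab
    have := Tuple.monotone_sort (fun a => -‖α a‖) hab
    simpa using this
  have hs : ∑ a, ‖(α ∘ σ) a‖ ^ 2 = ∑ a, ‖α a‖ ^ 2 := Equiv.sum_comp σ (fun a => ‖α a‖ ^ 2)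
  have hk : (Finset.univ.filter fun a => (α ∘ σ) a ≠ 0).card ≤ k := by
    refine le_trans (le_of_eq ?_) hα
    refine Finset.card_bij (fun a _ => σ a) (by simp)
      (fun a _ b _ hab => σ.injective hab) fun b hb => ⟨σ.symm b, ?_, ?_⟩
    · simpa using hb
    · simp
  have h := hB.card_le_norm_permForm_of_antitone hR h0 hsum (α ∘ σ) hk hanti (by rwa [hs]) hx
  rw [hs] at h
  refine le_trans (le_of_eq ?_) h
  rw [Nat.cast_inj]
  have hp : ∀ π, permForm B (α ∘ σ) π = permForm B α (π * σ⁻¹) := fun π => by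
    rw [permForm_mul]
    rfl
  -- Right multiplication by the sorting permutation preserves the uniform distribution.
  refine Finset.card_bij (fun π _ => π * σ) (fun π hπ => ?_)
    (fun a _ b _ hab => mul_right_cancel hab) fun π hπ => ⟨π * σ⁻¹, ?_, ?_⟩
  · simp only [Finset.mem_filter, Finset.mem_univ, true_and, hp, mul_inv_cancel_right] at hπ ⊢
    exact hπ
  · simp only [Finset.mem_filter, Finset.mem_univ, true_and, hp] at hπ ⊢
    exact hπ
  · rw [inv_mul_cancel_right]

/-! ### Binary characters and chirps. -/

/-- The nontrivial additive character of the field with two elements. -/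
noncomputable def binSign (z : ZMod 2) : ℂ := (-1) ^ z.val

theorem neg_one_pow_eq_binSign (n : ℕ) : (-1 : ℂ) ^ n = binSign (n : ZMod 2) := by
  rw [binSign, ZMod.val_natCast, ← neg_one_pow_eq_pow_mod_two]

theorem binSign_zero : binSign 0 = 1 := by simp [binSign]

theorem binSign_one : binSign 1 = -1 := by simp [binSign, ZMod.val_one]

theorem binSign_add (z w : ZMod 2) : binSign (z + w) = binSign z * binSign w := by
  rw [← ZMod.natCast_zmod_val z, ← ZMod.natCast_zmod_val w, ← Nat.cast_add]
  simp only [← neg_one_pow_eq_binSign, pow_add]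

theorem binSign_mul_self (z : ZMod 2) : binSign z * binSign z = 1 := by
  rw [← binSign_add, CharTwo.add_self_eq_zero, binSign_zero]

theorem conj_binSign (z : ZMod 2) : starRingEnd ℂ (binSign z) = binSign z := by
  simp [binSign]

theorem norm_binSign (z : ZMod 2) : ‖binSign z‖ = 1 := by simp [binSign]

theorem mul_conj_of_norm_eq_one {z : ℂ} (h : ‖z‖ = 1) : z * starRingEnd ℂ z = 1 := by
  rw [Complex.mul_conj, Complex.normSq_eq_norm_sq, h]
  simp

/-- Orthogonality of the characters of the space of binary vectors. -/
theorem sum_binSign_dotProduct {m : ℕ} (v : BinVec m) :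
    ∑ x : BinVec m, binSign (v ⬝ᵥ x) = if v = 0 then (2 : ℂ) ^ m else 0 := by
  split_ifs with h
  · simp [h, binSign_zero, ZMod.card]
  · obtain ⟨i, hi⟩ := Function.ne_iff.1 h
    have hi1 : v i = 1 := Fin.eq_one_of_ne_zero (v i) hi
    have h1 : ∑ x : BinVec m, binSign (v ⬝ᵥ x) = ∑ x : BinVec m, -binSign (v ⬝ᵥ x) := by
      -- Translation by a unit vector on which `v` is `1` flips every sign.
      rw [← Equiv.sum_comp (Equiv.addRight (Pi.single i 1 : BinVec m))]
      refine Finset.sum_congr rfl fun x _ => ?_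
      rw [Equiv.coe_addRight, dotProduct_add, binSign_add, dotProduct_single, hi1, mul_one,
        binSign_one, mul_neg_one]
    rw [Finset.sum_neg_distrib] at h1
    exact self_eq_neg.1 h1

theorem BinVec.add_self {m : ℕ} (x : BinVec m) : x + x = 0 :=
  funext fun _ => CharTwo.add_self_eq_zero _

theorem BinVec.add_eq_zero {m : ℕ} {x y : BinVec m} : x + y = 0 ↔ x = y := by
  simp only [funext_iff, Pi.add_apply, Pi.zero_apply, CharTwo.add_eq_zero]

theorem BinMat.sub_eq_add {m : ℕ} (P Q : BinMat m) : P - Q = P + Q := by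
  ext i j
  exact CharTwo.sub_eq_add _ _

theorem neg_one_pow_liftDot {m : ℕ} (b x : BinVec m) :
    (-1 : ℂ) ^ liftDot b x = binSign (b ⬝ᵥ x) := by
  rw [neg_one_pow_eq_binSign, liftDot, dotProduct]
  push_cast
  simp

theorem neg_one_pow_hammingNorm {m : ℕ} (b : BinVec m) :
    (-1 : ℂ) ^ hammingNorm b = binSign (b ⬝ᵥ 1) := by
  rw [neg_one_pow_eq_binSign, hammingNorm, dotProduct_one, Finset.card_filter]
  push_cast
  congr 1
  refine Finset.sum_congr rfl fun i _ => ?_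
  split_ifs with h
  · exact (Fin.eq_one_of_ne_zero (b i) h).symm
  · exact (not_not.1 h).symm

theorem I_pow_add_two_mul (n k : ℕ) :
    Complex.I ^ (n + 2 * k) = Complex.I ^ n * (-1) ^ k := by
  rw [pow_add, pow_mul, Complex.I_sq]

theorem norm_I_pow (n : ℕ) : ‖Complex.I ^ n‖ = 1 := by simp

theorem I_pow_congr {n k : ℕ} (h : (n : ZMod 4) = k) : Complex.I ^ n = Complex.I ^ k := by
  rw [Complex.I_pow_eq_pow_mod n, Complex.I_pow_eq_pow_mod k,
    (ZMod.natCast_eq_natCast_iff' n k 4).1 h]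

/-- The weight `wt(b)` is absorbed as `b ⬝ᵥ 1`, so `b` enters only through a character evaluated at
`1 + x`. -/
theorem chirp_eq {m : ℕ} (P : BinMat m) (b x : BinVec m) :
    chirp P b x = Complex.I ^ hammingNorm P.diag * Complex.I ^ liftQuad P x *
      binSign (b ⬝ᵥ (1 + x)) := by
  rw [chirp, I_pow_add_two_mul, I_pow_add_two_mul, neg_one_pow_hammingNorm, neg_one_pow_liftDot,
    dotProduct_add, binSign_add]
  ring

theorem norm_chirp {m : ℕ} (P : BinMat m) (b x : BinVec m) : ‖chirp P b x‖ = 1 := by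
  rw [chirp_eq, norm_mul, norm_mul, norm_I_pow, norm_I_pow, norm_binSign]
  norm_num

theorem natCast_val_add_zmod_two (u v : ZMod 2) : (((u + v).val : ℕ) : ZMod 4) =
    (u.val : ZMod 4) + (v.val : ZMod 4) + 2 * ((u.val : ZMod 4) * (v.val : ZMod 4)) := by
  revert u v
  decide

/-- Modulo 4 the lift of a sum is `u + v + 2uv`. By the symmetry of `P` the two kinds of terms with
a carry `2uv` in one factor coincide and add up to a multiple of 4; the mixed terms coincide as well
and give the factor 2. -/
theorem liftQuad_add {m : ℕ} {P : BinMat m} (hP : P.IsSymm) (x z : BinVec m) :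
    (liftQuad P (x + z) : ZMod 4) =
      ((liftQuad P x + liftQuad P z +
        2 * ∑ i, ∑ j, (z i).val * (P i j).val * (x j).val : ℕ) : ZMod 4) := by
  have h4 : (4 : ZMod 4) = 0 := rfl
  have hsymm : ∀ f : Fin m → Fin m → ZMod 4,
      ∑ i, ∑ j, f i j * ((P i j).val : ZMod 4) = ∑ i, ∑ j, f j i * ((P i j).val : ZMod 4) := by
    intro f
    rw [Finset.sum_comm]
    refine Finset.sum_congr rfl fun i _ => Finset.sum_congr rfl fun j _ => ?_
    rw [hP.apply i j]
  simp only [liftQuad]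
  push_cast
  simp only [Pi.add_apply, natCast_val_add_zmod_two]
  set u : Fin m → ZMod 4 := fun i => ((x i).val : ZMod 4) with hu
  set v : Fin m → ZMod 4 := fun i => ((z i).val : ZMod 4) with hv
  set p : Fin m → Fin m → ZMod 4 := fun i j => ((P i j).val : ZMod 4) with hp
  have e1 : ∑ i, ∑ j, u i * v j * p i j = ∑ i, ∑ j, v i * u j * p i j := by
    rw [hsymm]
    simp only [mul_comm, hp]
  have e2 : ∑ i, ∑ j, (u i + v i) * (u j * v j) * p i j =
      ∑ i, ∑ j, (u i * v i) * (u j + v j) * p i j := by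
    rw [hsymm]
    refine Finset.sum_congr rfl fun i _ => Finset.sum_congr rfl fun j _ => ?_
    rw [mul_comm (u j + v j)]
  calc ∑ i, ∑ j, (u i + v i + 2 * (u i * v i)) * p i j * (u j + v j + 2 * (u j * v j))
      = ∑ i, ∑ j, u i * p i j * u j + ∑ i, ∑ j, v i * p i j * v j +
          (∑ i, ∑ j, u i * v j * p i j + ∑ i, ∑ j, v i * u j * p i j) +
          2 * (∑ i, ∑ j, (u i + v i) * (u j * v j) * p i j +
            ∑ i, ∑ j, (u i * v i) * (u j + v j) * p i j) := by
        simp only [← Finset.sum_add_distrib, Finset.mul_sum]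
        refine Finset.sum_congr rfl fun i _ => Finset.sum_congr rfl fun j _ => ?_
        linear_combination (u i * v i * u j * v j * p i j) * h4
    _ = ∑ i, ∑ j, u i * p i j * u j + ∑ i, ∑ j, v i * p i j * v j +
          2 * ∑ i, ∑ j, v i * u j * p i j := by
        rw [e1, e2]
        linear_combination (∑ i, ∑ j, (u i * v i) * (u j + v j) * p i j) * h4
    _ = _ := by
        simp only [mul_right_comm (v _)]
        rfl

theorem I_pow_liftQuad_add {m : ℕ} {P : BinMat m} (hP : P.IsSymm) (x z : BinVec m) :
    Complex.I ^ liftQuad P (x + z) =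
      Complex.I ^ liftQuad P x * Complex.I ^ liftQuad P z * binSign (P.mulVec z ⬝ᵥ x) := by
  rw [I_pow_congr (liftQuad_add hP x z), I_pow_add_two_mul, pow_add, neg_one_pow_eq_binSign]
  congr 2
  push_cast
  simp only [ZMod.natCast_val, ZMod.cast_id', id_eq, dotProduct, Matrix.mulVec, Finset.sum_mul]
  rw [Finset.sum_comm]
  refine Finset.sum_congr rfl fun i _ => Finset.sum_congr rfl fun j _ => ?_
  rw [← hP.apply i j]
  ring

/-- A chirp is multiplied by a character under translations. -/
theorem chirp_add {m : ℕ} {P : BinMat m} (hP : P.IsSymm) (b x z : BinVec m) :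
    chirp P b (x + z) = Complex.I ^ liftQuad P z * binSign (b ⬝ᵥ z) *
      binSign (P.mulVec z ⬝ᵥ x) * chirp P b x := by
  rw [chirp_eq, chirp_eq, I_pow_liftQuad_add hP, ← add_assoc, dotProduct_add b, binSign_add]
  ring

theorem sum_chirp_eq_zero {m : ℕ} (P : BinMat m) {x : BinVec m} (hx : x ≠ 1) :
    ∑ b, chirp P b x = 0 := by
  simp only [chirp_eq, ← Finset.mul_sum, dotProduct_comm _ (1 + x), sum_binSign_dotProduct]
  rw [if_neg, mul_zero]
  intro h
  exact hx (BinVec.add_eq_zero.1 h).symm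

/-! ### Correlations of chirps. -/

/-- The twisted correlation of two chirps at the offset `a`. -/
noncomputable def chirpCorr {m : ℕ} (a l : BinVec m) (p q : BinMat m × BinVec m) : ℂ :=
  ∑ x, binSign (l ⬝ᵥ x) * chirp p.1 p.2 (x + a) * starRingEnd ℂ (chirp q.1 q.2 x)

theorem crossCorr_sensingMatrix {m C : ℕ} {D : Submodule (ZMod 2) (BinMat m)}
    (col : Fin C ≃ D × BinVec m) (a l : BinVec m) (s t : Fin C) :
    crossCorr (sensingMatrix col) a l s t =
      chirpCorr a l ((col s).1, (col s).2) ((col t).1, (col t).2) := by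
  simp only [crossCorr, chirpCorr, neg_one_pow_liftDot]
  rfl

/-- Substitute `x + a` for `x` and use `a + a = 0`. -/
theorem conj_chirpCorr {m : ℕ} (a l : BinVec m) (p q : BinMat m × BinVec m) :
    chirpCorr a l q p = binSign (l ⬝ᵥ a) * starRingEnd ℂ (chirpCorr a l p q) := by
  simp only [chirpCorr, map_sum, map_mul, Complex.conj_conj, conj_binSign, Finset.mul_sum]
  rw [← Equiv.sum_comp (Equiv.addRight a)]
  refine Finset.sum_congr rfl fun x _ => ?_
  have : x + a + a = x := by rw [add_assoc, BinVec.add_self, add_zero]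
  rw [Equiv.coe_addRight, this, dotProduct_add, binSign_add]
  ring

/-- The sum of `chirp P b x` over `b` vanishes unless `x` is the all-ones vector, and `x` and `x +
a` cannot both be that vector. -/
theorem sum_sum_chirpCorr_eq_zero {m : ℕ} {a : BinVec m} (ha : a ≠ 0) (l : BinVec m)
    (P Q : BinMat m) : ∑ b, ∑ c, chirpCorr a l (P, b) (Q, c) = 0 := by
  have h : ∀ b c, chirpCorr a l (P, b) (Q, c) =
    ∑ x, binSign (l ⬝ᵥ x) * (chirp P b (x + a) * starRingEnd ℂ (chirp Q c x)) := fun b c => by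
      simp only [chirpCorr, mul_assoc]
  simp only [h]
  rw [Finset.sum_congr rfl fun b _ => Finset.sum_comm, Finset.sum_comm]
  refine Finset.sum_eq_zero fun x _ => ?_
  simp only [← Finset.mul_sum, ← Finset.sum_mul, ← map_sum]
  by_cases hx : x = 1
  · rw [sum_chirp_eq_zero P (x := x + a), zero_mul, mul_zero]
    rw [hx]
    intro h
    exact ha (left_eq_add.1 h.symm)
  · rw [sum_chirp_eq_zero Q hx, map_zero, mul_zero, mul_zero]

theorem norm_sq_sum_eq {m : ℕ} (F : BinVec m → ℂ) :
    ((‖∑ x, F x‖ ^ 2 : ℝ) : ℂ) = ∑ z, ∑ x, F (x + z) * starRingEnd ℂ (F x) := by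
  rw [← Complex.normSq_eq_norm_sq, ← Complex.mul_conj, map_sum, Finset.mul_sum, Finset.sum_comm]
  refine Finset.sum_congr rfl fun x _ => ?_
  rw [Finset.sum_mul, ← Equiv.sum_comp (Equiv.addLeft x)]
  rfl

/-- The modulus of the correlation of two chirps is controlled by the kernel of the sum of their
matrices. -/
theorem norm_sq_chirpCorr_le {m : ℕ} (a l : BinVec m) {P Q : BinMat m} (hP : P.IsSymm)
    (hQ : Q.IsSymm) (b c : BinVec m) :
    ‖chirpCorr a l (P, b) (Q, c)‖ ^ 2 ≤
      2 ^ m * (Finset.univ.filter fun z => (P - Q).mulVec z = 0).card := by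
  set F : BinVec m → ℂ := fun x =>
    binSign (l ⬝ᵥ x) * chirp P b (x + a) * starRingEnd ℂ (chirp Q c x) with hF
  have hFn : ∀ x, ‖F x‖ = 1 := by
    intro x
    rw [hF, norm_mul, norm_mul, RCLike.norm_conj, norm_chirp, norm_chirp, norm_binSign]
    norm_num
  -- The autocorrelation of the summand at shift `z` is a unit constant times a character, trivial
  -- exactly when `z` lies in the kernel of `P - Q`; orthogonality kills the other shifts.
  have hshift : ∀ z, ∃ w : ℂ, ‖w‖ = 1 ∧
      ∀ x, F (x + z) * starRingEnd ℂ (F x) = w * binSign ((P - Q).mulVec z ⬝ᵥ x) := by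
    intro z
    refine ⟨binSign (l ⬝ᵥ z) * (Complex.I ^ liftQuad P z * binSign (b ⬝ᵥ z) *
      binSign (P.mulVec z ⬝ᵥ a)) *
      starRingEnd ℂ (Complex.I ^ liftQuad Q z * binSign (c ⬝ᵥ z)), ?_, fun x => ?_⟩
    · simp only [norm_mul, RCLike.norm_conj, norm_I_pow, norm_binSign, mul_one]
    · have h1 := mul_conj_of_norm_eq_one (hFn x)
      have hz : x + z + a = x + a + z := add_right_comm _ _ _
      have h2 : F (x + z) = binSign (l ⬝ᵥ z) * (Complex.I ^ liftQuad P z * binSign (b ⬝ᵥ z) *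
          binSign (P.mulVec z ⬝ᵥ a)) *
          starRingEnd ℂ (Complex.I ^ liftQuad Q z * binSign (c ⬝ᵥ z)) *
          binSign ((P - Q).mulVec z ⬝ᵥ x) * F x := by
        simp only [hF]
        rw [hz, chirp_add hP, chirp_add hQ, dotProduct_add, dotProduct_add, binSign_add,
          binSign_add, map_mul, map_mul, conj_binSign, BinMat.sub_eq_add, Matrix.add_mulVec,
          add_dotProduct, binSign_add]
        ring
      rw [h2, mul_assoc, h1, mul_one]
  choose w hw1 hw using hshift
  have h := norm_sq_sum_eq F
  simp only [hw, ← Finset.mul_sum, sum_binSign_dotProduct] at h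
  have h3 : ‖∑ x, F x‖ ^ 2 = ‖∑ z, w z * if (P - Q).mulVec z = 0 then (2 : ℂ) ^ m else 0‖ := by
    rw [← h, Complex.norm_real, Real.norm_of_nonneg (by positivity)]
  change ‖∑ x, F x‖ ^ 2 ≤ _
  rw [h3]
  refine (norm_sum_le _ _).trans ?_
  rw [mul_comm, ← nsmul_eq_mul, ← Finset.sum_const, Finset.sum_filter]
  refine Finset.sum_le_sum fun z _ => ?_
  rw [norm_mul, hw1, one_mul]
  split_ifs <;> simp

theorem norm_chirpCorr_le {m : ℕ} (a l : BinVec m) (p q : BinMat m × BinVec m) :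
    ‖chirpCorr a l p q‖ ≤ 2 ^ m := by
  refine (norm_sum_le _ _).trans (le_of_eq ?_)
  simp [norm_chirp, norm_binSign, ZMod.card]

/-- For equal matrices the quadratic phases cancel and the summand is a constant times the character
of `l + P a + b + c`. -/
theorem chirpCorr_eq_zero {m : ℕ} (a l : BinVec m) {P : BinMat m} (hP : P.IsSymm)
    {b c : BinVec m} (h : c ≠ b + l + P.mulVec a) : chirpCorr a l (P, b) (P, c) = 0 := by
  have h1 : ∀ x, binSign (l ⬝ᵥ x) * chirp P b (x + a) * starRingEnd ℂ (chirp P c x) =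
      Complex.I ^ liftQuad P a * binSign (b ⬝ᵥ a) * binSign ((b + c) ⬝ᵥ 1) *
        binSign ((l + P.mulVec a + b + c) ⬝ᵥ x) := by
    intro x
    have h2 := mul_conj_of_norm_eq_one (norm_I_pow (hammingNorm P.diag))
    have h3 := mul_conj_of_norm_eq_one (norm_I_pow (liftQuad P x))
    rw [chirp_add hP, chirp_eq, chirp_eq]
    simp only [map_mul, conj_binSign, add_dotProduct, dotProduct_add, binSign_add]
    linear_combination (binSign (l ⬝ᵥ x) * Complex.I ^ liftQuad P a * binSign (b ⬝ᵥ a) *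
      binSign (P.mulVec a ⬝ᵥ x) * binSign (b ⬝ᵥ 1) * binSign (b ⬝ᵥ x) * binSign (c ⬝ᵥ 1) *
      binSign (c ⬝ᵥ x)) * ((Complex.I ^ liftQuad P x *
        starRingEnd ℂ (Complex.I ^ liftQuad P x)) * h2 + h3)
  simp only [chirpCorr, h1, ← Finset.mul_sum, sum_binSign_dotProduct]
  rw [if_neg, mul_zero]
  intro h0
  apply h
  rw [BinVec.add_eq_zero] at h0
  rw [← h0]
  abel

/-- Parseval: for fixed `Q` the chirps form an orthogonal basis, and the function expanded in it has
modulus one everywhere. -/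
theorem sum_norm_sq_chirpCorr {m : ℕ} (a l : BinVec m) (p : BinMat m × BinVec m) (Q : BinMat m) :
    ∑ c, ‖chirpCorr a l p (Q, c)‖ ^ 2 = (2 ^ m) ^ 2 := by
  set v : BinVec m → ℂ := fun x => binSign (l ⬝ᵥ x) * chirp p.1 p.2 (x + a) *
    starRingEnd ℂ (chirp Q 0 x) with hv
  have hvn : ∀ x, ‖v x‖ = 1 := by
    intro x
    rw [hv, norm_mul, norm_mul, RCLike.norm_conj, norm_chirp, norm_chirp, norm_binSign]
    norm_num
  have h1 : ∀ c x, binSign (l ⬝ᵥ x) * chirp p.1 p.2 (x + a) * starRingEnd ℂ (chirp Q c x) =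
      v x * binSign (c ⬝ᵥ (1 + x)) := by
    intro c x
    simp only [hv, chirp_eq, map_mul, conj_binSign, zero_dotProduct, binSign_zero, mul_one]
    ring
  apply Complex.ofReal_injective
  push_cast
  have h2 : ∀ c, (‖chirpCorr a l p (Q, c)‖ : ℂ) ^ 2 = ∑ z, ∑ x,
      v (x + z) * starRingEnd ℂ (v x) * binSign (c ⬝ᵥ z) := by
    intro c
    have h := norm_sq_sum_eq fun x => v x * binSign (c ⬝ᵥ (1 + x))
    rw [Complex.ofReal_pow] at h
    simp only [chirpCorr, h1]
    rw [h]
    refine Finset.sum_congr rfl fun z _ => Finset.sum_congr rfl fun x _ => ?_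
    rw [← add_assoc, dotProduct_add c (1 + x), binSign_add, map_mul, conj_binSign]
    linear_combination (v (x + z) * starRingEnd ℂ (v x) * binSign (c ⬝ᵥ z)) *
      binSign_mul_self (c ⬝ᵥ (1 + x))
  simp only [h2]
  rw [Finset.sum_comm]
  have h3 : ∀ z, ∑ c, ∑ x, v (x + z) * starRingEnd ℂ (v x) * binSign (c ⬝ᵥ z) =
      if z = 0 then (2 ^ m) ^ 2 else 0 := by
    intro z
    simp only [← Finset.sum_mul]
    rw [← Finset.mul_sum]
    simp only [dotProduct_comm _ z, sum_binSign_dotProduct]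
    split_ifs with hz
    · simp only [hz, add_zero, mul_conj_of_norm_eq_one (hvn _)]
      simp [ZMod.card, sq]
    · rw [mul_zero]
  simp only [h3, Finset.sum_ite_eq', Finset.mem_univ, if_true]

theorem IsDelsarteGoethals.card_ker_le {m r : ℕ} {D : Submodule (ZMod 2) (BinMat m)}
    (hD : IsDelsarteGoethals m r D) {P Q : BinMat m} (hP : P ∈ D) (hQ : Q ∈ D) (h : P ≠ Q) :
    (Finset.univ.filter fun z => (P - Q).mulVec z = 0).card ≤ 2 ^ (2 * r) := by
  have h1 := hD.rank P hP Q hQ h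
  have h2 := (P - Q).mulVecLin.finrank_range_add_finrank_ker
  rw [Module.finrank_fin_fun] at h2
  change (P - Q).rank + _ = m at h2
  have h3 : (Finset.univ.filter fun z => (P - Q).mulVec z = 0).card =
      Nat.card (LinearMap.ker (P - Q).mulVecLin) := by
    rw [← Fintype.card_subtype, ← Nat.card_eq_fintype_card]
    rfl
  rw [h3, Module.natCard_eq_pow_finrank (K := ZMod 2), Nat.card_zmod]
  exact Nat.pow_le_pow_right two_pos (by omega)

-- More than two kernel vectors force rank at most one, hence the form `v vᵀ` with `v` the diagonal.
-- The 64 symmetric matrices are checked directly.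
set_option maxRecDepth 100000 in
theorem offDiag_eq_of_two_lt_card_ker : ∀ a b c d e f : ZMod 2,
    2 < (Finset.univ.filter fun z : BinVec 3 =>
      (!![a, b, c; b, d, e; c, e, f] : BinMat 3).mulVec z = 0).card →
    b = a * d ∧ c = a * f ∧ e = d * f := by
  decide +kernel

/-- A symmetric binary `3 × 3` matrix of rank at most one is determined by its diagonal. -/
theorem BinMat.eq_mul_of_two_lt_card_ker {Q : BinMat 3} (hQ : Q.IsSymm)
    (h : 2 < (Finset.univ.filter fun z => Q.mulVec z = 0).card) (i j : Fin 3) :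
    Q i j = Q i i * Q j j := by
  have hQ' : Q = !![Q 0 0, Q 0 1, Q 0 2; Q 0 1, Q 1 1, Q 1 2; Q 0 2, Q 1 2, Q 2 2] := by
    ext i j
    fin_cases i <;> fin_cases j <;> simp [hQ.apply 0 1, hQ.apply 0 2, hQ.apply 1 2]
  have hs : ∀ x : ZMod 2, x = x * x := by decide
  obtain ⟨h1, h2, h3⟩ := offDiag_eq_of_two_lt_card_ker _ _ _ _ _ _ (hQ' ▸ h)
  have h1' := (hQ.apply 0 1).trans h1
  have h2' := (hQ.apply 0 2).trans h2
  have h3' := (hQ.apply 1 2).trans h3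
  fin_cases i <;> fin_cases j
  · exact hs _
  · exact h1
  · exact h2
  · exact h1'.trans (mul_comm _ _)
  · exact hs _
  · exact h3
  · exact h2'.trans (mul_comm _ _)
  · exact h3'.trans (mul_comm _ _)
  · exact hs _

/-! ### Normalised correlations of the columns. -/

/-- The normalising factor `N^(-3/2)` with `N = 2^m`. -/
noncomputable def corrScale (m : ℕ) : ℝ := (2 ^ m : ℝ) ^ (-(3 / 2) : ℝ)

theorem corrScale_pos (m : ℕ) : 0 < corrScale m := Real.rpow_pos_of_pos (by positivity) _

theorem corrScale_sq (m : ℕ) : corrScale m ^ 2 = ((2 ^ m : ℝ) ^ 3)⁻¹ := by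
  rw [corrScale, ← Real.rpow_natCast, ← Real.rpow_mul (by positivity),
    ← Real.rpow_natCast (2 ^ m : ℝ) 3, ← Real.rpow_neg (by positivity)]
  norm_num

section Correlations

variable {m C : ℕ} {D : Submodule (ZMod 2) (BinMat m)} (col : Fin C ≃ D × BinVec m)
  (a l : BinVec m)

/-- The normalised correlations of columns with different matrices. -/
noncomputable def distinctCorr (s t : Fin C) : ℂ :=
  if (col s).1 = (col t).1 then 0 else corrScale m * crossCorr (sensingMatrix col) a l s t

/-- The normalised correlations of different columns with the same matrix. -/
noncomputable def sameCorr (s t : Fin C) : ℂ :=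
  if s ≠ t ∧ (col s).1 = (col t).1 then corrScale m * crossCorr (sensingMatrix col) a l s t else 0

theorem distinctCorr_add_sameCorr (s t : Fin C) : distinctCorr col a l s t +
    sameCorr col a l s t =
      if s ≠ t then corrScale m * crossCorr (sensingMatrix col) a l s t else 0 := by
  rw [distinctCorr, sameCorr]
  rcases eq_or_ne s t with rfl | h
  · simp
  · by_cases h1 : (col s).1 = (col t).1 <;> simp [h, h1]

theorem distinctCorr_self (s : Fin C) : distinctCorr col a l s s = 0 := by simp [distinctCorr]

theorem distinctCorr_herm :
    (∀ s t, distinctCorr col a l t s = starRingEnd ℂ (distinctCorr col a l s t)) ∨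
      (∀ s t, distinctCorr col a l t s = -starRingEnd ℂ (distinctCorr col a l s t)) := by
  have h : ∀ s t, distinctCorr col a l t s =
      binSign (l ⬝ᵥ a) * starRingEnd ℂ (distinctCorr col a l s t) := by
    intro s t
    simp only [distinctCorr, @eq_comm _ (col t).1]
    split_ifs
    · simp
    · rw [crossCorr_sensingMatrix, crossCorr_sensingMatrix, conj_chirpCorr, map_mul,
        Complex.conj_ofReal]
      ring
  by_cases h0 : l ⬝ᵥ a = 0
  · left
    intro s t
    rw [h, h0, binSign_zero, one_mul]
  · right
    intro s t
    have h1 : l ⬝ᵥ a = 1 := Fin.eq_one_of_ne_zero _ h0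
    rw [h, h1, binSign_one, neg_one_mul]

theorem sum_distinctCorr (ha : a ≠ 0) : ∑ s, ∑ t, distinctCorr col a l s t = 0 := by
  classical
  have := Fintype.ofFinite D
  set F : D × BinVec m → D × BinVec m → ℂ := fun p q => if p.1 = q.1 then 0 else
    corrScale m * chirpCorr a l (p.1, p.2) (q.1, q.2) with hF
  have h : ∀ s t, distinctCorr col a l s t = F (col s) (col t) := by
    intro s t
    simp only [distinctCorr, crossCorr_sensingMatrix, hF]
  simp only [h]
  rw [Finset.sum_congr rfl fun s _ => Equiv.sum_comp col (F (col s)),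
    Equiv.sum_comp col fun p => ∑ q, F p q]
  simp only [Fintype.sum_prod_type]
  refine Finset.sum_eq_zero fun P _ => ?_
  rw [Finset.sum_comm]
  refine Finset.sum_eq_zero fun Q _ => ?_
  simp only [hF]
  split_ifs
  · simp
  · simp only [← Finset.mul_sum]
    rw [sum_sum_chirpCorr_eq_zero ha, mul_zero]

variable {col a l}

/-- The rank condition leaves at most `2^(2r)` kernel vectors, so the square is at most `N^(-3) * N
* 2^(2r)`. -/
theorem norm_sq_distinctCorr_le {r : ℕ} (hD : IsDelsarteGoethals m r D) (s t : Fin C) :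
    ‖distinctCorr col a l s t‖ ^ 2 ≤ (2 ^ r / 2 ^ m : ℝ) ^ 2 := by
  rw [distinctCorr]
  split_ifs with h
  · rw [norm_zero, zero_pow two_ne_zero]
    positivity
  · rw [norm_mul, Complex.norm_real, Real.norm_of_nonneg (corrScale_pos m).le, mul_pow,
      corrScale_sq, crossCorr_sensingMatrix]
    have h1 := norm_sq_chirpCorr_le a l (hD.symm _ (col s).1.2) (hD.symm _ (col t).1.2)
      (col s).2 (col t).2
    have h2 : ((Finset.univ.filter fun z => ((col s).1.1 - (col t).1.1).mulVec z = 0).card : ℝ)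
        ≤ 2 ^ (2 * r) := by
      exact_mod_cast hD.card_ker_le (col s).1.2 (col t).1.2 fun h' => h (Subtype.ext h')
    have h3 := h1.trans (mul_le_mul_of_nonneg_left h2 (by positivity))
    refine (mul_le_mul_of_nonneg_left h3 (by positivity)).trans (le_of_eq ?_)
    rw [pow_mul']
    field_simp

theorem sparseRowBound_distinctCorr {r : ℕ} (hD : IsDelsarteGoethals m r D) (k : ℕ) :
    SparseRowBound k (√k * (2 ^ r / 2 ^ m)) (distinctCorr col a l) where
  nonneg := by positivity
  herm := distinctCorr_herm col a l
  row s T hT := by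
    rw [mul_pow, Real.sq_sqrt (Nat.cast_nonneg k)]
    refine (Finset.sum_le_card_nsmul _ _ _ fun t _ => norm_sq_distinctCorr_le hD s t).trans ?_
    rw [nsmul_eq_mul]
    exact mul_le_mul_of_nonneg_right (by exact_mod_cast hT) (by positivity)

end Correlations

/-! ### Reduction of the cross term to a permutation form. -/

/-- A bilinear form whose matrix has at most one nonzero entry in every row and column. -/
theorem norm_sum_sum_le_of_matching {ι : Type*} [Fintype ι] (K : ι → ι → ℂ) (c : ℝ) (hc : 0 ≤ c)
    (hK : ∀ i j, ‖K i j‖ ≤ c) (hrow : ∀ i j j', K i j ≠ 0 → K i j' ≠ 0 → j = j')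
    (hcol : ∀ i i' j, K i j ≠ 0 → K i' j ≠ 0 → i = i') (α : ι → ℂ) :
    ‖∑ i, ∑ j, α i * starRingEnd ℂ (α j) * K i j‖ ≤ c * ∑ i, ‖α i‖ ^ 2 := by
  classical
  set e : ι → ι → ℝ := fun i j => if K i j ≠ 0 then 1 else 0 with he
  have he0 : ∀ i j, 0 ≤ e i j := fun i j => by
    simp only [he]
    split_ifs <;> norm_num
  have herow : ∀ i, ∑ j, e i j ≤ 1 := by
    intro i
    simp only [he, Finset.sum_boole]
    exact_mod_cast Finset.card_le_one.2 fun j hj j' hj' =>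
      hrow i j j' (Finset.mem_filter.1 hj).2 (Finset.mem_filter.1 hj').2
  have hecol : ∀ j, ∑ i, e i j ≤ 1 := by
    intro j
    simp only [he, Finset.sum_boole]
    exact_mod_cast Finset.card_le_one.2 fun i hi i' hi' =>
      hcol i i' j (Finset.mem_filter.1 hi).2 (Finset.mem_filter.1 hi').2
  calc ‖∑ i, ∑ j, α i * starRingEnd ℂ (α j) * K i j‖
      -- `2 ‖α i‖ ‖α j‖ ≤ ‖α i‖² + ‖α j‖²`; each index then occurs at most once as a row and once as
      -- a column.
      ≤ ∑ i, ∑ j, c / 2 * (‖α i‖ ^ 2 * e i j + ‖α j‖ ^ 2 * e i j) := by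
        refine (norm_sum_le _ _).trans (Finset.sum_le_sum fun i _ =>
          (norm_sum_le _ _).trans (Finset.sum_le_sum fun j _ => ?_))
        rw [norm_mul, norm_mul, RCLike.norm_conj]
        simp only [he]
        split_ifs with h
        · have h1 := mul_le_mul_of_nonneg_left (hK i j)
            (mul_nonneg (norm_nonneg (α i)) (norm_nonneg (α j)))
          have h2 := mul_nonneg hc (sq_nonneg (‖α i‖ - ‖α j‖))
          nlinarith
        · rw [not_not.1 h]
          simp
    _ = c / 2 * (∑ i, ‖α i‖ ^ 2 * ∑ j, e i j + ∑ j, ‖α j‖ ^ 2 * ∑ i, e i j) := by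
        simp only [← Finset.mul_sum, Finset.sum_add_distrib]
        congr 2
        rw [Finset.sum_comm]
        simp only [Finset.mul_sum]
    _ ≤ c / 2 * (∑ i, ‖α i‖ ^ 2 * 1 + ∑ j, ‖α j‖ ^ 2 * 1) := by
        gcongr with i _ j _
        · exact herow i
        · exact hecol j
    _ = _ := by
        simp only [mul_one]
        ring

section Reduction

variable {m C : ℕ} {D : Submodule (ZMod 2) (BinMat m)} {col : Fin C ≃ D × BinVec m}
  {a l : BinVec m}

theorem sameCorr_ne_zero (hD : ∀ P ∈ D, P.IsSymm) {s t : Fin C} (h : sameCorr col a l s t ≠ 0) :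
    (col s).1 = (col t).1 ∧ (col t).2 = (col s).2 + l + (col s).1.1.mulVec a := by
  rw [sameCorr] at h
  split_ifs at h with h1
  · refine ⟨h1.2, ?_⟩
    by_contra hne
    apply h
    rw [crossCorr_sensingMatrix, ← h1.2, chirpCorr_eq_zero a l (hD _ (col s).1.2) hne, mul_zero]
  · exact absurd rfl h

theorem norm_sameCorr_le (s t : Fin C) : ‖sameCorr col a l s t‖ ≤ corrScale m * 2 ^ m := by
  have := corrScale_pos m
  rw [sameCorr]
  split_ifs
  · rw [norm_mul, Complex.norm_real, Real.norm_of_nonneg this.le, crossCorr_sensingMatrix]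
    exact mul_le_mul_of_nonneg_left (norm_chirpCorr_le _ _ _ _) this.le
  · rw [norm_zero]
    positivity

/-- With the matrix shared, each of `(col s).2` and `(col t).2` determines the other, so the nonzero
entries form a partial matching. -/
theorem norm_sum_sameCorr_le (hD : ∀ P ∈ D, P.IsSymm) {ι : Type*} [Fintype ι] (t : ι → Fin C)
    (ht : Function.Injective t) (α : ι → ℂ) :
    ‖∑ i, ∑ j, α i * starRingEnd ℂ (α j) * sameCorr col a l (t i) (t j)‖ ≤
      corrScale m * 2 ^ m * ∑ i, ‖α i‖ ^ 2 := by
  have := corrScale_pos m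
  refine norm_sum_sum_le_of_matching (fun i j => sameCorr col a l (t i) (t j)) _ (by positivity)
    (fun i j => norm_sameCorr_le _ _) (fun i j j' h h' => ?_) (fun i i' j h h' => ?_) α
  · obtain ⟨h1, h2⟩ := sameCorr_ne_zero hD h
    obtain ⟨h3, h4⟩ := sameCorr_ne_zero hD h'
    exact ht (col.injective (Prod.ext (h1.symm.trans h3) (h2.trans h4.symm)))
  · obtain ⟨h1, h2⟩ := sameCorr_ne_zero hD h
    obtain ⟨h3, h4⟩ := sameCorr_ne_zero hD h'
    have h5 := h1.trans h3.symm
    rw [h2, h5] at h4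
    exact ht (col.injective (Prod.ext h5 (add_right_cancel (add_right_cancel h4))))

/-- Extension by zero lets `k` coefficients be treated as coefficients on all columns, as `permForm`
requires. -/
theorem sum_sum_extend {ι κ : Type*} [Fintype ι] [Fintype κ] (e : ι → κ)
    (he : Function.Injective e) (α : ι → ℂ) (F : κ → κ → ℂ) :
    ∑ i, ∑ j, Function.extend e α 0 i * starRingEnd ℂ (Function.extend e α 0 j) * F i j =
      ∑ i, ∑ j, α i * starRingEnd ℂ (α j) * F (e i) (e j) := by
  have h0 : ∀ i ∉ Set.range e, Function.extend e α 0 i = 0 := fun i hi =>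
    Function.extend_apply' _ _ _ hi
  symm
  refine Fintype.sum_of_injective e he _ _ (fun i hi => by simp [h0 i hi]) fun i => ?_
  refine Fintype.sum_of_injective e he _ _ (fun j hj => by simp [h0 j hj]) fun j => ?_
  rw [he.extend_apply, he.extend_apply]

theorem sum_norm_sq_extend {ι κ : Type*} [Fintype ι] [Fintype κ] (e : ι → κ)
    (he : Function.Injective e) (α : ι → ℂ) :
    ∑ i, ‖Function.extend e α 0 i‖ ^ 2 = ∑ i, ‖α i‖ ^ 2 := by
  symm
  refine Fintype.sum_of_injective e he _ _ (fun i hi => ?_) fun i => ?_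
  · rw [Function.extend_apply' _ _ _ hi]
    simp
  · rw [he.extend_apply]

theorem card_extend_ne_zero_le {ι κ : Type*} [Fintype ι] [Fintype κ] (e : ι → κ) (α : ι → ℂ) :
    (Finset.univ.filter fun i => Function.extend e α 0 i ≠ 0).card ≤ Fintype.card ι := by
  classical
  refine (Finset.card_le_card fun i hi => ?_).trans
    (Finset.card_image_le (s := Finset.univ) (f := e))
  by_contra h
  refine (Finset.mem_filter.1 hi).2 (Function.extend_apply' _ _ _ fun ⟨j, hj⟩ => h ?_)
  exact Finset.mem_image.2 ⟨j, Finset.mem_univ _, hj⟩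

/-- Up to a small term, the cross term is a quadratic form in the correlations of columns with
different matrices. -/
theorem norm_crossTerm_le {k : ℕ} (hD : ∀ P ∈ D, P.IsSymm) (hk : k ≤ C)
    (α : EuclideanSpace ℂ (Fin k)) (π : Equiv.Perm (Fin C)) :
    ‖crossTerm (sensingMatrix col) a l α (fun i => π (Fin.castLE hk i))‖ ≤
      ‖permForm (distinctCorr col a l) (Function.extend (Fin.castLE hk) α 0) π‖ +
        corrScale m * 2 ^ m * ‖α‖ ^ 2 := by
  have hinj : Function.Injective fun i => π (Fin.castLE hk i) :=
    π.injective.comp (Fin.castLE_injective hk)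
  have h : crossTerm (sensingMatrix col) a l α (fun i => π (Fin.castLE hk i)) =
      permForm (distinctCorr col a l) (Function.extend (Fin.castLE hk) α 0) π +
      ∑ i, ∑ j, α i * starRingEnd ℂ (α j) *
        sameCorr col a l (π (Fin.castLE hk i)) (π (Fin.castLE hk j)) := by
    rw [permForm, sum_sum_extend (Fin.castLE hk) (Fin.castLE_injective hk) α
      fun i j => distinctCorr col a l (π i) (π j), ← Finset.sum_add_distrib, crossTerm,
      Finset.mul_sum]
    refine Finset.sum_congr rfl fun i _ => ?_
    rw [← Finset.sum_add_distrib, Finset.mul_sum]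
    refine Finset.sum_congr rfl fun j _ => ?_
    rw [← mul_add, distinctCorr_add_sameCorr]
    simp only [corrScale, ne_eq, hinj.eq_iff]
    split_ifs <;> ring
  rw [h, EuclideanSpace.norm_sq_eq]
  exact (norm_add_le _ _).trans (add_le_add_right (norm_sum_sameCorr_le hD _ hinj α) _)

end Reduction

/-! ### The exceptional case `m = 3`, `r = 1`. -/

section Cubic

variable {C : ℕ} {D : Submodule (ZMod 2) (BinMat 3)} {col : Fin C ≃ D × BinVec 3}
  {a l : BinVec 3}

-- Such a difference has rank at most one and is determined by its diagonal, for which there are 8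
-- choices.
open Classical in
theorem card_two_lt_card_ker_le (hD : ∀ P ∈ D, P.IsSymm) [Fintype D] (P : D) :
    (Finset.univ.filter fun Q : D =>
      2 < (Finset.univ.filter fun z => (P.1 - Q.1).mulVec z = 0).card).card ≤ 8 := by
  have h8 : (Finset.univ : Finset (BinVec 3)).card = 8 := by
    simp [ZMod.card]
  rw [← h8]
  refine Finset.card_le_card_of_injOn (fun Q => (P.1 - Q.1).diag) (fun _ _ => Finset.mem_univ _)
    fun Q hQ Q' hQ' h => ?_
  have h1 := BinMat.eq_mul_of_two_lt_card_ker ((hD _ P.2).sub (hD _ Q.2))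
    (Finset.mem_filter.1 hQ).2
  have h2 := BinMat.eq_mul_of_two_lt_card_ker ((hD _ P.2).sub (hD _ Q'.2))
    (Finset.mem_filter.1 hQ').2
  refine Subtype.ext (sub_right_injective (b := P.1) ?_)
  ext i j
  have hi := congrFun h i
  have hj := congrFun h j
  simp only [Matrix.diag_apply] at hi hj
  change (P.1 - Q.1) i j = (P.1 - Q'.1) i j
  rw [h1, h2, hi, hj]

/-- For `m = 3` and `r = 1` few columns attain the maximal correlation with a given column. -/
theorem sparseRowBound_distinctCorr_three (hD : IsDelsarteGoethals 3 1 D) (k : ℕ) :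
    SparseRowBound k √((k + 16) / 32) (distinctCorr col a l) where
  nonneg := Real.sqrt_nonneg _
  herm := distinctCorr_herm col a l
  row s T hT := by
    classical
    have := Fintype.ofFinite D
    rw [Real.sq_sqrt (by positivity)]
    set bad : D → Prop := fun Q =>
      2 < (Finset.univ.filter fun z => ((col s).1.1 - Q.1).mulVec z = 0).card with hbad
    set G : D × BinVec 3 → ℝ := fun q => if bad q.1 then
      ‖chirpCorr a l ((col s).1, (col s).2) (q.1, q.2)‖ ^ 2 else 0 with hG
    have hG0 : ∀ q, 0 ≤ G q := fun q => by
      simp only [hG]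
      split_ifs <;> positivity
    -- Here `N^(-3) = 1/512`. Outside `bad` the squared correlation is at most `8 * 2 = 16`; inside
    -- it is at most `32`, hence at most `16` plus half of itself.
    have hterm : ∀ t, ‖distinctCorr col a l s t‖ ^ 2 ≤ 16 / 512 + G (col t) / 1024 := by
      intro t
      have hGt := hG0 (col t)
      rw [distinctCorr]
      split_ifs with h
      · rw [norm_zero]
        linarith
      · rw [norm_mul, Complex.norm_real, Real.norm_of_nonneg (corrScale_pos 3).le, mul_pow,
          corrScale_sq, crossCorr_sensingMatrix]
        have h1 := norm_sq_chirpCorr_le a l (hD.symm _ (col s).1.2) (hD.symm _ (col t).1.2)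
          (col s).2 (col t).2
        by_cases hb : bad (col t).1
        · have h2 : ((Finset.univ.filter fun z =>
              ((col s).1.1 - (col t).1.1).mulVec z = 0).card : ℝ) ≤ 4 := by
            exact_mod_cast hD.card_ker_le (col s).1.2 (col t).1.2 fun h' => h (Subtype.ext h')
          simp only [hG, if_pos hb]
          norm_num at h1 ⊢
          linarith
        · have h2 : ((Finset.univ.filter fun z =>
              ((col s).1.1 - (col t).1.1).mulVec z = 0).card : ℝ) ≤ 2 := by
            exact_mod_cast not_lt.1 hb
          norm_num at h1 ⊢
          linarith
    -- At most 8 bad matrices, each contributing `64` by Parseval.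
    have hsum : ∑ t, G (col t) ≤ 512 := by
      rw [Equiv.sum_comp col G, Fintype.sum_prod_type]
      have h1 : ∀ Q : D, ∑ c, G (Q, c) = if bad Q then 64 else 0 := by
        intro Q
        simp only [hG]
        split_ifs
        · rw [sum_norm_sq_chirpCorr]
          norm_num
        · simp
      rw [Finset.sum_congr rfl fun Q _ => h1 Q, ← Finset.sum_filter, Finset.sum_const, nsmul_eq_mul]
      have h2 : ((Finset.univ.filter bad).card : ℝ) ≤ 8 := by
        exact_mod_cast card_two_lt_card_ker_le hD.symm (col s).1
      linarith
    have hTk : (T.card : ℝ) ≤ k := by exact_mod_cast hT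
    have hTG : ∑ t ∈ T, G (col t) ≤ 512 :=
      (Finset.sum_le_sum_of_subset_of_nonneg (Finset.subset_univ _) fun t _ _ => hG0 _).trans hsum
    calc _ ≤ ∑ t ∈ T, (16 / 512 + G (col t) / 1024) := Finset.sum_le_sum fun t _ => hterm t
      _ = T.card * (16 / 512) + (∑ t ∈ T, G (col t)) / 1024 := by
        rw [Finset.sum_add_distrib, Finset.sum_const, nsmul_eq_mul, Finset.sum_div]
      _ ≤ _ := by linarith

end Cubic

/-! ### From row bounds to probability. -/

theorem ofReal_one_sub_le_uniformOfFintype {ι : Type*} [Fintype ι] [Nonempty ι] [DecidableEq ι]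
    (S : Set ι) (bad : Finset ι) (hS : ∀ x, x ∉ bad → x ∈ S) {δ : ℝ}
    (hδ : (bad.card : ℝ) ≤ Fintype.card ι * δ) :
    ENNReal.ofReal (1 - δ) ≤ (PMF.uniformOfFintype ι).toOuterMeasure S := by
  classical
  have hι : (0 : ℝ) < Fintype.card ι := by exact_mod_cast Fintype.card_pos
  rw [PMF.toOuterMeasure_uniformOfFintype_apply, ENNReal.le_div_iff_mul_le (by simp) (by simp),
    ← ENNReal.ofReal_natCast (Fintype.card ι), ← ENNReal.ofReal_natCast (Fintype.card S),
    ← ENNReal.ofReal_mul' hι.le]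
  refine ENNReal.ofReal_le_ofReal ?_
  have h1 : badᶜ.card ≤ Fintype.card S := by
    rw [← Set.toFinset_card]
    exact Finset.card_le_card fun x hx => Set.mem_toFinset.2 (hS x (Finset.mem_compl.1 hx))
  have h2 : (badᶜ.card : ℝ) + bad.card = Fintype.card ι := by
    exact_mod_cast Finset.card_compl_add_card bad
  have h3 : (badᶜ.card : ℝ) ≤ Fintype.card S := by exact_mod_cast h1
  linarith

section Tail

variable {m C k : ℕ} {D : Submodule (ZMod 2) (BinMat m)} {col : Fin C ≃ D × BinVec m}
  {a : BinVec m}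

/-- The simultaneous bound for all cross terms follows from row bounds by concentration. -/
theorem ofReal_one_sub_le_crossTerm_of_exp (hD : ∀ P ∈ D, P.IsSymm) (ha : a ≠ 0) (hk : k ≤ C)
    (α : EuclideanSpace ℂ (Fin k)) {R ε δ : ℝ} (hR : 0 < R)
    (hrow : ∀ l, SparseRowBound k R (distinctCorr col a l))
    (hε : corrScale m * 2 ^ m ≤ ε)
    (hexp : 2 * Real.exp (-((ε - corrScale m * 2 ^ m) ^ 2 / (32 * R ^ 2))) ≤ δ / 2 ^ m) :
    ENNReal.ofReal (1 - δ) ≤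
      (PMF.uniformOfFintype (Equiv.Perm (Fin C))).toOuterMeasure
        {π | ∀ l : BinVec m, ‖crossTerm (sensingMatrix col) a l α
          (fun i => π (Fin.castLE hk i))‖ ≤ ε * ‖α‖ ^ 2} := by
  classical
  set β := Function.extend (Fin.castLE hk) α 0 with hβ
  set x := ε - corrScale m * 2 ^ m with hx
  have hA : ∑ i, ‖β i‖ ^ 2 = ‖α‖ ^ 2 := by
    rw [EuclideanSpace.norm_sq_eq]
    exact sum_norm_sq_extend _ (Fin.castLE_injective hk) α
  have hβk : (Finset.univ.filter fun i => β i ≠ 0).card ≤ k := by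
    simpa using card_extend_ne_zero_le (Fin.castLE hk) α
  have hδ : 0 ≤ δ := by
    have := (by positivity : (0 : ℝ) ≤ 2 * Real.exp (-(x ^ 2 / (32 * R ^ 2)))).trans hexp
    rwa [le_div_iff₀ (by positivity), zero_mul] at this
  set bad : BinVec m → Finset (Equiv.Perm (Fin C)) := fun l => Finset.univ.filter fun π =>
    x * ‖α‖ ^ 2 < ‖permForm (distinctCorr col a l) β π‖ with hbad
  have hcard : ∀ l, ((bad l).card : ℝ) ≤ C.factorial * (δ / 2 ^ m) := by
    intro l
    -- The tail bound needs `α ≠ 0`; for `α = 0` the strict inequality in `bad` is never satisfied.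
    rcases (sq_nonneg ‖α‖).eq_or_lt with h0 | h0
    · have he : bad l = ∅ := by
        refine Finset.filter_eq_empty_iff.2 fun π _ => ?_
        have := (hrow l).norm_permForm_le β hβk π
        rw [hA, ← h0, mul_zero] at this
        rw [← h0, mul_zero]
        exact not_lt.2 this
      rw [he, Finset.card_empty, Nat.cast_zero]
      positivity
    · have h := (hrow l).card_le_norm_permForm hR (distinctCorr_self col a l)
        (sum_distinctCorr col a l ha) β hβk (hA ▸ h0) (sub_nonneg.2 hε)
      rw [hA] at h
      refine le_trans ?_ (h.trans (mul_le_mul_of_nonneg_left hexp (by positivity)))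
      refine Nat.cast_le.2 (Finset.card_le_card fun π hπ => Finset.mem_filter.2
        ⟨Finset.mem_univ _, ?_⟩)
      exact (Finset.mem_filter.1 hπ).2.le
  refine ofReal_one_sub_le_uniformOfFintype _ (Finset.univ.biUnion bad) (fun π hπ => ?_) ?_
  · intro l
    have h1 : ‖permForm (distinctCorr col a l) β π‖ ≤ x * ‖α‖ ^ 2 := by
      by_contra h
      exact hπ (Finset.mem_biUnion.2 ⟨l, Finset.mem_univ _, Finset.mem_filter.2
        ⟨Finset.mem_univ _, not_le.1 h⟩⟩)
    refine (norm_crossTerm_le hD hk α π).trans ((add_le_add_left h1 _).trans (le_of_eq ?_))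
    rw [hx]
    ring
  · have h1 : ((Finset.univ.biUnion bad).card : ℝ) ≤ ∑ l, ((bad l).card : ℝ) := by
      exact_mod_cast Finset.card_biUnion_le
    refine h1.trans ((Finset.sum_le_card_nsmul _ _ _ fun l _ => hcard l).trans (le_of_eq ?_))
    rw [Fintype.card_perm, Fintype.card_fin, nsmul_eq_mul, Finset.card_univ, Fintype.card_fun,
      ZMod.card, Fintype.card_fin]
    push_cast
    field_simp

theorem ofReal_one_sub_le_crossTerm_of_le (hD : ∀ P ∈ D, P.IsSymm) (hk : k ≤ C)
    (α : EuclideanSpace ℂ (Fin k)) {R ε δ : ℝ} (hδ : 0 ≤ δ)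
    (hrow : ∀ l, SparseRowBound k R (distinctCorr col a l))
    (hε : √k * R + corrScale m * 2 ^ m ≤ ε) :
    ENNReal.ofReal (1 - δ) ≤
      (PMF.uniformOfFintype (Equiv.Perm (Fin C))).toOuterMeasure
        {π | ∀ l : BinVec m, ‖crossTerm (sensingMatrix col) a l α
          (fun i => π (Fin.castLE hk i))‖ ≤ ε * ‖α‖ ^ 2} := by
  classical
  refine ofReal_one_sub_le_uniformOfFintype _ ∅ (fun π _ => ?_) (by
    rw [Finset.card_empty, Nat.cast_zero]
    positivity)
  intro l
  have h1 := (hrow l).norm_permForm_le (Function.extend (Fin.castLE hk) α 0)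
    (by simpa using card_extend_ne_zero_le (Fin.castLE hk) α) π
  rw [sum_norm_sq_extend _ (Fin.castLE_injective hk), ← EuclideanSpace.norm_sq_eq] at h1
  refine (norm_crossTerm_le hD hk α π).trans ((add_le_add_left h1 _).trans ?_)
  rw [← add_mul]
  exact mul_le_mul_of_nonneg_right hε (by positivity)

end Tail

/-! ### Numerical comparison of the bounds. -/

theorem two_mul_exp_neg_le {L X p : ℝ} (hp : Real.exp (-L) = p) (h : L + Real.log 2 ≤ X) :
    2 * Real.exp (-X) ≤ p := by
  nth_rw 1 [← hp, ← Real.exp_log (two_pos : (0 : ℝ) < 2), ← Real.exp_add]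
  exact Real.exp_le_exp.2 (by linarith)

theorem corrScale_mul_sq (m : ℕ) : (corrScale m * 2 ^ m) ^ 2 = (2 ^ m : ℝ)⁻¹ := by
  rw [mul_pow, corrScale_sq]
  field_simp

theorem two_pow_rpow_one_sub_div {m r : ℕ} (hm : 0 < m) :
    (2 ^ m : ℝ) ^ (1 - (r : ℝ) / m) = 2 ^ m / 2 ^ r := by
  have hm' : (m : ℝ) ≠ 0 := by exact_mod_cast hm.ne'
  rw [Real.rpow_sub (by positivity), Real.rpow_one]
  congr 1
  rw [← Real.rpow_natCast 2 m, ← Real.rpow_mul two_pos.le, mul_div_cancel₀ _ hm',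
    Real.rpow_natCast]

section Numerics

variable {k : ℕ} {M L κ ε : ℝ}

/-- The left side squared is at most `8M² + 2M ≤ 3M`, while `k * L ≥ 2` makes `ε² ≥ 16M`. -/
theorem coherence_le_of_le_two (hk1 : 1 ≤ k) (hk : k ≤ 2) (hM0 : 0 < M) (hM : M ≤ 1 / 8)
    (hL : 3 * Real.log 2 ≤ L) (hκ : κ ^ 2 ≤ M) (hε : 0 ≤ ε) (hε2 : ε ^ 2 = 8 * k * L * M) :
    k * M + κ ≤ ε := by
  have hlog := Real.log_two_gt_d9
  have hk1' : (1 : ℝ) ≤ k := by exact_mod_cast hk1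
  have hk2' : (k : ℝ) ≤ 2 := by exact_mod_cast hk
  refine le_of_sq_le_sq ?_ hε
  have h1 : (k * M + κ) ^ 2 ≤ 2 * (k * M) ^ 2 + 2 * κ ^ 2 := by
    nlinarith [sq_nonneg (k * M - κ)]
  have h2 : (k * M) ^ 2 ≤ 4 * M ^ 2 := by
    rw [mul_pow]
    exact mul_le_mul_of_nonneg_right (by nlinarith) (sq_nonneg M)
  have h3 : M ^ 2 ≤ M / 8 := by nlinarith
  have h4 : 2 ≤ k * L := by nlinarith
  have h5 : 2 * M ≤ k * L * M := mul_le_mul_of_nonneg_right h4 hM0.le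
  rw [hε2]
  nlinarith

/-- From `k ≥ 3` comes `k * L ≥ 6`, so `κ ≤ ε / 6` and `(ε - κ)² ≥ (2/3) ε²`. As `log 2 ≤ L / 3`,
what is required is at most `(16/3) M ε² ≤ (2/3) ε²`. -/
theorem tail_exponent_of_three_le (hk : 3 ≤ k) (hM0 : 0 < M) (hM : M ≤ 1 / 8)
    (hL : 3 * Real.log 2 ≤ L) (hκ : κ ^ 2 ≤ M) (hε : 0 ≤ ε)
    (hε2 : ε ^ 2 = 8 * k * L * M) :
    κ ≤ ε ∧ L + Real.log 2 ≤ (ε - κ) ^ 2 / (32 * (k * M ^ 2)) := by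
  have hlog := Real.log_two_gt_d9
  have hk' : (3 : ℝ) ≤ k := by exact_mod_cast hk
  have hkL : 6 ≤ k * L := by nlinarith
  have hκε : 6 * κ ≤ ε := by
    refine le_of_sq_le_sq ?_ hε
    have : 6 * M ≤ k * L * M := mul_le_mul_of_nonneg_right hkL hM0.le
    rw [hε2]
    nlinarith
  refine ⟨by linarith, ?_⟩
  rw [le_div_iff₀ (by positivity)]
  have h1 : (L + Real.log 2) * (32 * (k * M ^ 2)) ≤ 4 / 3 * L * (32 * (k * M ^ 2)) :=
    mul_le_mul_of_nonneg_right (by linarith) (by positivity)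
  have h2 : 4 / 3 * L * (32 * (k * M ^ 2)) = 16 / 3 * M * ε ^ 2 := by
    rw [hε2]
    ring
  have h3 : M * ε ^ 2 ≤ 1 / 8 * ε ^ 2 := mul_le_mul_of_nonneg_right hM (sq_nonneg ε)
  have h4 : 6 * κ * ε ≤ ε * ε := mul_le_mul_of_nonneg_right hκε hε
  nlinarith [sq_nonneg κ]

theorem coherence_le_of_le_four (hk1 : 1 ≤ k) (hk : k ≤ 4) (hL : Real.log 2 ≤ L)
    (hκ : κ ^ 2 = 1 / 2) (hε : 0 ≤ ε) (hε2 : ε ^ 2 = 8 * k * L * (1 / 2)) :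
    k * (1 / 2) + κ ≤ ε := by
  have hlog := Real.log_two_gt_d9
  have hκ' : κ ≤ 0.71 := by nlinarith
  have hk1' : (1 : ℝ) ≤ k := by exact_mod_cast hk1
  have hk2' : (k : ℝ) ≤ 4 := by exact_mod_cast hk
  refine le_of_sq_le_sq ?_ hε
  have h1 : 0.69 * (k : ℝ) ≤ k * L := by nlinarith
  have h2 : k * κ ≤ k * 0.71 := mul_le_mul_of_nonneg_left hκ' (by linarith)
  rw [hε2]
  nlinarith

theorem coherence_le_of_le_forty_eight (hk1 : 1 ≤ k) (hk : k ≤ 48) (hL : 3 * Real.log 2 ≤ L)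
    (hκ : κ ^ 2 = 1 / 8) (hε : 0 ≤ ε) (hε2 : ε ^ 2 = 8 * k * L * (1 / 4)) :
    k * (1 / 4) + κ ≤ ε := by
  have hlog := Real.log_two_gt_d9
  have hκ' : κ ≤ 0.36 := by nlinarith
  have hk1' : (1 : ℝ) ≤ k := by exact_mod_cast hk1
  have hk2' : (k : ℝ) ≤ 48 := by exact_mod_cast hk
  refine le_of_sq_le_sq ?_ hε
  have h1 : 2 * (k : ℝ) ≤ k * L := by nlinarith
  have h2 : k * κ ≤ k * 0.36 := mul_le_mul_of_nonneg_left hκ' (by linarith)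
  rw [hε2]
  nlinarith

/-- For `k ≥ 49` one has `k + 16 ≤ (65/49) k`, so `(130/147) ε²` suffices; since `ε ≥ 14`,
subtracting `κ ≤ 0.36` costs less than the gap. -/
theorem tail_exponent_of_forty_nine_le (hk : 49 ≤ k) (hL : 3 * Real.log 2 ≤ L) (hκ0 : 0 ≤ κ)
    (hκ : κ ^ 2 = 1 / 8) (hε : 0 ≤ ε) (hε2 : ε ^ 2 = 8 * k * L * (1 / 4)) :
    κ ≤ ε ∧ L + Real.log 2 ≤ (ε - κ) ^ 2 / (32 * ((k + 16) / 32)) := by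
  have hlog := Real.log_two_gt_d9
  have hκ' : κ ≤ 0.36 := by nlinarith
  have hk' : (49 : ℝ) ≤ k := by exact_mod_cast hk
  have hkL : 98 ≤ k * L := by nlinarith
  have hε14 : 14 ≤ ε := le_of_sq_le_sq (by rw [hε2]; linarith) hε
  refine ⟨by linarith, ?_⟩
  rw [le_div_iff₀ (by positivity)]
  have h1 : (L + Real.log 2) * (32 * ((k + 16) / 32)) ≤ 4 / 3 * L * (65 / 49 * k) :=
    mul_le_mul (by linarith) (by linarith) (by positivity) (by linarith)
  have h2 : 4 / 3 * L * (65 / 49 * k) = 130 / 147 * ε ^ 2 := by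
    rw [hε2]
    ring
  have h3 : κ * ε ≤ 0.36 * ε := mul_le_mul_of_nonneg_right hκ' hε
  have h4 : 14 * ε ≤ ε * ε := mul_le_mul_of_nonneg_right hε14 hε
  nlinarith [sq_nonneg κ]

end Numerics

/-! ### The theorem: choice of regime. -/

theorem mainTheorem1 (m r k : ℕ) (hm : Odd m) (hr : 2 * r + 1 ≤ m)
    (hk : k ≤ 2 ^ ((r + 2) * m))
    (D : Submodule (ZMod 2) (BinMat m)) (hD : IsDelsarteGoethals m r D)
    (col : Fin (2 ^ ((r + 2) * m)) ≃ D × BinVec m)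
    (a : BinVec m) (ha : a ≠ 0) (α : EuclideanSpace ℂ (Fin k)) (δ : ℝ) (hδ : 0 < δ) :
    ENNReal.ofReal (1 - δ) ≤
      (PMF.uniformOfFintype (Equiv.Perm (Fin (2 ^ ((r + 2) * m))))).toOuterMeasure
        {π | ∀ l : BinVec m,
          ‖crossTerm (sensingMatrix col) a l α (fun i => π (Fin.castLE hk i))‖ ≤
            Real.sqrt (8 * k * Real.log (2 ^ m / δ) / (2 ^ m : ℝ) ^ (1 - (r : ℝ) / m)) *
              ‖α‖ ^ 2} := by

  classical
  rcases le_or_gt 1 δ with hδ1 | hδ1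
  · rw [ENNReal.ofReal_of_nonpos (by linarith)]
    exact zero_le
  have hm0 : 0 < m := by omega
  rcases Nat.eq_zero_or_pos k with rfl | hk0
  · refine ofReal_one_sub_le_uniformOfFintype _ ∅ (fun π _ => ?_) (by
      rw [Finset.card_empty, Nat.cast_zero]
      positivity)
    intro l
    rw [crossTerm, Fin.sum_univ_zero, mul_zero, norm_zero]
    positivity
  set L := Real.log (2 ^ m / δ) with hL
  set κ := corrScale m * 2 ^ m with hκ
  set M : ℝ := 2 ^ r / 2 ^ m with hM
  have hM0 : 0 < M := by positivity
  have hκ0 : 0 ≤ κ := mul_nonneg (corrScale_pos m).le (by positivity)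
  have hκ2 : κ ^ 2 = (2 ^ m : ℝ)⁻¹ := corrScale_mul_sq m
  have hκM : κ ^ 2 ≤ M := by
    rw [hκ2, hM, div_eq_mul_inv]
    exact le_mul_of_one_le_left (by positivity) (one_le_pow₀ one_le_two)
  have hexpL : Real.exp (-L) = δ / 2 ^ m := by
    rw [hL, Real.exp_neg, Real.exp_log (by positivity), inv_div]
  have hmL : m * Real.log 2 ≤ L := by
    rw [hL, Real.log_div (by positivity) hδ.ne', Real.log_pow]
    linarith [Real.log_nonpos hδ.le hδ1.le]
  have hlog : 0 < Real.log 2 := Real.log_pos one_lt_two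
  have hL0 : 0 ≤ L := le_trans (by positivity) hmL
  rw [two_pow_rpow_one_sub_div hm0]
  set ε := √(8 * k * L / (2 ^ m / 2 ^ r)) with hεdef
  have hε : 0 ≤ ε := Real.sqrt_nonneg _
  have hε2 : ε ^ 2 = 8 * k * L * M := by
    rw [hεdef, Real.sq_sqrt (by positivity), hM, div_div_eq_mul_div, mul_div_assoc]
  have hrow := fun l => sparseRowBound_distinctCorr (col := col) (a := a) (l := l) hD k
  have hkk : √(k : ℝ) * (√k * M) = k * M := by
    rw [← mul_assoc, Real.mul_self_sqrt (Nat.cast_nonneg k)]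
  have hkM : (√(k : ℝ) * M) ^ 2 = k * M ^ 2 := by
    rw [mul_pow, Real.sq_sqrt (Nat.cast_nonneg k)]
  have hkpos : 0 < √(k : ℝ) := Real.sqrt_pos.2 (by exact_mod_cast hk0)
  have h3L : 3 ≤ m → 3 * Real.log 2 ≤ L := fun h =>
    le_trans (mul_le_mul_of_nonneg_right (by exact_mod_cast h) hlog.le) hmL
  by_cases hmr : r + 3 ≤ m
  · have hM8 : M ≤ 1 / 8 := by
      rw [hM, div_le_div_iff₀ (by positivity) (by norm_num), one_mul]
      calc (2 : ℝ) ^ r * 8 = 2 ^ (r + 3) := by rw [pow_add]; norm_num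
        _ ≤ 2 ^ m := pow_le_pow_right₀ one_le_two hmr
    rcases le_or_gt k 2 with hk2 | hk2
    · refine ofReal_one_sub_le_crossTerm_of_le hD.symm hk α hδ.le hrow ?_
      rw [hkk]
      exact coherence_le_of_le_two hk0 hk2 hM0 hM8 (h3L (by omega)) hκM hε hε2
    · obtain ⟨h1, h2⟩ :=
        tail_exponent_of_three_le hk2 hM0 hM8 (h3L (by omega)) hκM hε hε2
      refine ofReal_one_sub_le_crossTerm_of_exp hD.symm ha hk α (mul_pos hkpos hM0) hrow h1
        (two_mul_exp_neg_le hexpL ?_)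
      rw [hkM]
      exact h2
  · obtain ⟨q, rfl⟩ := hm
    -- `m` is odd with `2r + 1 ≤ m ≤ r + 2`, so `r ≤ 1`.
    have hq : (q = 0 ∧ r = 0) ∨ (q = 1 ∧ r = 1) := by omega
    rcases hq with ⟨rfl, rfl⟩ | ⟨rfl, rfl⟩
    · have hM' : M = 1 / 2 := by rw [hM]; norm_num
      refine ofReal_one_sub_le_crossTerm_of_le hD.symm hk α hδ.le hrow ?_
      rw [hkk, hM']
      rw [hM'] at hε2
      -- There are only `2^((0+2)*1) = 4` columns.
      refine coherence_le_of_le_four hk0 (hk.trans (by norm_num)) ?_ ?_ hε hε2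
      · simpa using hmL
      · rw [← hκ, hκ2]
        norm_num
    · have hM' : M = 1 / 4 := by rw [hM]; norm_num
      have hκ8 : κ ^ 2 = 1 / 8 := by
        rw [hκ2]
        norm_num
      -- With `M = 1/4` the generic `R² = kM²` would give an exponent of at most `L` for `x ≤ ε`,
      -- short of `L + log 2`; large `k` therefore uses `R² = (k + 16)/32`.
      rcases le_or_gt k 48 with hk48 | hk48
      · refine ofReal_one_sub_le_crossTerm_of_le hD.symm hk α hδ.le hrow ?_
        rw [hkk, hM']
        rw [hM'] at hε2
        exact coherence_le_of_le_forty_eight hk0 hk48 (h3L (by norm_num)) hκ8 hε hε2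
      · rw [hM'] at hε2
        obtain ⟨h1, h2⟩ :=
          tail_exponent_of_forty_nine_le hk48 (h3L (by norm_num)) hκ0 hκ8 hε hε2
        refine ofReal_one_sub_le_crossTerm_of_exp hD.symm ha hk α
          (Real.sqrt_pos.2 (by positivity))
          (fun l => sparseRowBound_distinctCorr_three hD k) h1 (two_mul_exp_neg_le hexpL ?_)
        rw [Real.sq_sqrt (by positivity)]
        exact h2
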